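/- Let $d,m\in\mathbb N$, let $A\in\mathbb R^{d\times d}$ and $B\in\mathbb R^{d\times m}$ satisfy the Kalman rank condition $\operatorname{rank}[B,AB,\dots,A^{N-1}B]=d$ for some $N\in\mathbb N$, and let $n$ be the least such $N$. For $0\le k\le n$ put $E_k=\operatorname{span}\{A^lBv: v\in\mathbb R^m,\ 0\le l<k\}$ and $d_k=\dim E_k$ (so $d_0=0$, $d_n=d$). Let $e_1,\dots,e_d$ be an orthonormal basis of $\mathbb R^d$ such that $e_1,\dots,e_{d_k}$ is a basis of $E_k$ for every $k$. Say that an index $j$ lies in block $k$ if $d_{k-1}<j\le d_k$. For $1\le k\le n$ let $u_k$ be the $(d_k-d_{k-1})\times m$ matrix whose rows are, for $j$ in block $k$, $\frac1{(k-1)!}e_j^{*}A^{k-1}B$. Let $$D_\varepsilon=\operatorname{diag}(\varepsilon^{k-1}),\qquad J_t=\operatorname{diag}(t^{k-1/2})\qquad(j\text{ in block }k),$$ $$\hat U(r)=\begin{pmatrix}u_1\\ r u_2\\ \vdots\\ r^{n-1}u_n\end{pmatrix},\qquad V=(V_{kl})_{k,l=1}^n,\quad V_{kl}=(-1)^{l+1}u_ku_l^{*}\,\frac{(k-1)!\,(l-1)!}{(k+l-1)!}.$$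 Let $(W_t)_{t\in[0,1]}$ be a standard Brownian motion in $\mathbb R^m$. Then the following hold. (i) In the basis $e_1,\dots,e_d$, the rows of $\mathrm e^{\varepsilon rA}B$ with index in block $k$ are $\varepsilon^{k-1}r^{k-1}u_k+O(\varepsilon^{k})$ as $\varepsilon\downarrow0$, uniformly for $r$ in compact intervals. (ii) $V$ is invertible. (iii) The process $$F_t=\int_0^t\hat U(t-s)\,\mathrm dW_s-J_tVJ_tV^{-1}\int_0^1\hat U(1-s)\,\mathrm dW_s,\qquad t\in[0,1],$$ has a version with continuous paths, which is a Gaussian process. (iv) Let $x\in\mathbb R^d$ and, for $\varepsilon>0$, let $(x^\varepsilon_t)_{t\in[0,1]}$ be the solution of $\mathrm dx^\varepsilon_t=\varepsilon Ax^\varepsilon_t\,\mathrm dt+\sqrt\varepsilon B\,\mathrm dW_t$, $x^\varepsilon_0=x$. There is exactly one regular conditional distribution of the path $x^\varepsilon$ given $x^\varepsilon_1$ that depends on the value $y$ of $x^\varepsilon_1$ continuously with respect to weak convergence of probability measures on $C([0,1],\mathbb R^d)$; for $y\in\mathbb R^d$ let $z^\varepsilon(y)$ be a process with this conditional law given $x^\varepsilon_1=y$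 (the bridge from $x$ to $y$). (v) For $\Gamma^\varepsilon_t=\int_0^t\mathrm e^{-\varepsilon sA}BB^{*}\mathrm e^{-\varepsilon sA^{*}}\,\mathrm ds$ and $$\phi^\varepsilon_t(y)=\mathrm e^{\varepsilon tA}x+\mathrm e^{\varepsilon tA}\Gamma^\varepsilon_t(\Gamma^\varepsilon_1)^{-1}\bigl(\mathrm e^{-\varepsilon A}y-x\bigr),$$ and for all $x,y\in\mathbb R^d$, the rescaled fluctuations $$F^\varepsilon_t=\varepsilon^{-1/2}D_\varepsilon^{-1}\bigl(z^\varepsilon_t(y)-\phi^\varepsilon_t(y)\bigr),\qquad t\in[0,1],$$ written in coordinates in the basis $e_1,\dots,e_d$, converge weakly on $C([0,1],\mathbb R^d)$ with the uniform topology to $(F_t)_{t\in[0,1]}$ as $\varepsilon\downarrow0$. The limit depends neither on $x$ nor on $y$. -/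

import Mathlib

open MeasureTheory ProbabilityTheory Filter Topology

noncomputable section

namespace KalmanBridge

/-! ### Path space and linear algebra -/

/-- Continuous paths `[0,1] → ℝ^d`, with the topology of uniform convergence. -/
abbrev PathSpace (d : ℕ) : Type := C(unitInterval, EuclideanSpace ℝ (Fin d))

/-- Path space carries its Borel sigma-algebra. -/
instance instMeasurableSpacePathSpace (d : ℕ) : MeasurableSpace (PathSpace d) := borel _

instance instBorelSpacePathSpace (d : ℕ) : BorelSpace (PathSpace d) := ⟨rfl⟩

/-- The linear map between Euclidean spaces given by a matrix (in the standard bases). -/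
def matCLM {p q : ℕ} (M : Matrix (Fin p) (Fin q) ℝ) :
    EuclideanSpace ℝ (Fin q) →L[ℝ] EuclideanSpace ℝ (Fin p) :=
  LinearMap.toContinuousLinearMap (Matrix.toEuclideanLin M)

section LinearAlgebra

variable {d m : ℕ}

/-- The block matrix `[B, AB, …, A^{N-1}B]`; its columns are indexed by pairs `(l, c)`. -/
def kalmanMatrix (A : Matrix (Fin d) (Fin d) ℝ) (B : Matrix (Fin d) (Fin m) ℝ) (N : ℕ) :
    Matrix (Fin d) (Fin N × Fin m) ℝ :=
  Matrix.of fun i lc => (A ^ (lc.1 : ℕ) * B) i lc.2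

/-- The Kalman rank condition: `rank [B, AB, …, A^{N-1}B] = d` for some `N`. -/
def KalmanCondition (A : Matrix (Fin d) (Fin d) ℝ) (B : Matrix (Fin d) (Fin m) ℝ) : Prop :=
  ∃ N : ℕ, (kalmanMatrix A B N).rank = d

/-- `E_k = span {A^l B v : v ∈ ℝ^m, 0 ≤ l ≤ k - 1}`. In particular `E_0 = 0`. -/
def filtE (A : Matrix (Fin d) (Fin d) ℝ) (B : Matrix (Fin d) (Fin m) ℝ) (k : ℕ) :
    Submodule ℝ (EuclideanSpace ℝ (Fin d)) :=
  Submodule.span ℝ {w | ∃ l < k, ∃ v : EuclideanSpace ℝ (Fin m), w = matCLM (A ^ l * B) v}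

/-- `d_k = dim E_k`, so that `d_0 = 0`. -/
def dimE (A : Matrix (Fin d) (Fin d) ℝ) (B : Matrix (Fin d) (Fin m) ℝ) (k : ℕ) : ℕ :=
  Module.finrank ℝ (filtE A B k)

/-- The orthonormal basis `e` is adapted to the filtration: the first `d_k` basis vectors
span `E_k`. (Indices of `e` start at `0`. Once `E_k = ℝ^d` the condition is automatic.) -/
def IsAdapted (A : Matrix (Fin d) (Fin d) ℝ) (B : Matrix (Fin d) (Fin m) ℝ)
    (e : OrthonormalBasis (Fin d) ℝ (EuclideanSpace ℝ (Fin d))) : Prop :=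
  ∀ k : ℕ, Submodule.span ℝ (e '' {j : Fin d | (j : ℕ) < dimE A B k}) = filtE A B k

/-- The block number of the index `j`: the least `k` with `j < d_k`, i.e. the `k ≥ 1` with
`d_{k-1} ≤ j < d_k` (indices `j` start at `0`). -/
def level (A : Matrix (Fin d) (Fin d) ℝ) (B : Matrix (Fin d) (Fin m) ℝ) (j : Fin d) : ℕ :=
  sInf {k : ℕ | (j : ℕ) < dimE A B k}

/-- `D_ε`: diagonal, with entries `ε^{k-1}` in block `k`. -/
def matD (A : Matrix (Fin d) (Fin d) ℝ) (B : Matrix (Fin d) (Fin m) ℝ) (ε : ℝ) :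
    Matrix (Fin d) (Fin d) ℝ :=
  Matrix.diagonal fun j => ε ^ (level A B j - 1)

/-- `J_t`: diagonal, with entries `t^{k-1/2}` in block `k`. -/
def matJ (A : Matrix (Fin d) (Fin d) ℝ) (B : Matrix (Fin d) (Fin m) ℝ) (t : ℝ) :
    Matrix (Fin d) (Fin d) ℝ :=
  Matrix.diagonal fun j => t ^ ((level A B j : ℝ) - 1 / 2)

/-- The matrix `U^ε(r) = e^{εrA} B`, its rows being taken in the basis `e` of `ℝ^d`. -/
def matU (A : Matrix (Fin d) (Fin d) ℝ) (B : Matrix (Fin d) (Fin m) ℝ)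
    (e : OrthonormalBasis (Fin d) ℝ (EuclideanSpace ℝ (Fin d))) (ε r : ℝ) :
    Matrix (Fin d) (Fin m) ℝ :=
  Matrix.of fun j c =>
    inner ℝ (e j) (matCLM (NormedSpace.exp ((ε * r) • A) * B) (EuclideanSpace.single c 1))

/-- The blocks `u_1, …, u_n` stacked on top of each other: a row `j` in block `k` has the entries
`⟨e_j, A^{k-1} B f_c⟩ / (k-1)!`, with `f_c` the standard basis of `ℝ^m`. -/
def matLead (A : Matrix (Fin d) (Fin d) ℝ) (B : Matrix (Fin d) (Fin m) ℝ)
    (e : OrthonormalBasis (Fin d) ℝ (EuclideanSpace ℝ (Fin d))) :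
    Matrix (Fin d) (Fin m) ℝ :=
  Matrix.of fun j c =>
    inner ℝ (e j) (matCLM (A ^ (level A B j - 1) * B) (EuclideanSpace.single c 1)) /
      ((level A B j - 1).factorial : ℝ)

/-- `Û(r)`: the blocks `r^{k-1} u_k` stacked on top of each other. -/
def matUhat (A : Matrix (Fin d) (Fin d) ℝ) (B : Matrix (Fin d) (Fin m) ℝ)
    (e : OrthonormalBasis (Fin d) ℝ (EuclideanSpace ℝ (Fin d))) (r : ℝ) :
    Matrix (Fin d) (Fin m) ℝ :=
  Matrix.of fun j c => r ^ (level A B j - 1) * matLead A B e j c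

/-- `V`, the block matrix with blocks
`V_{kl} = (-1)^{l+1} u_k u_l^* (k-1)! (l-1)! / (k+l-1)!`. -/
def matV (A : Matrix (Fin d) (Fin d) ℝ) (B : Matrix (Fin d) (Fin m) ℝ)
    (e : OrthonormalBasis (Fin d) ℝ (EuclideanSpace ℝ (Fin d))) :
    Matrix (Fin d) (Fin d) ℝ :=
  Matrix.of fun i j =>
    (-1 : ℝ) ^ (level A B j + 1) * (matLead A B e * (matLead A B e).transpose) i j *
      (((level A B i - 1).factorial : ℝ) * ((level A B j - 1).factorial : ℝ) /
        ((level A B i + level A B j - 1).factorial : ℝ))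

/-- The integrand `e^{-εsA} B B^* e^{-εsA^*}`. -/
def gammaIntegrand (A : Matrix (Fin d) (Fin d) ℝ) (B : Matrix (Fin d) (Fin m) ℝ) (ε s : ℝ) :
    Matrix (Fin d) (Fin d) ℝ :=
  NormedSpace.exp (-(ε * s) • A) * B * B.transpose * NormedSpace.exp (-(ε * s) • A.transpose)

/-- `Γ^ε_t = ∫_0^t e^{-εsA} B B^* e^{-εsA^*} ds` (integrated entry by entry). -/
def matGamma (A : Matrix (Fin d) (Fin d) ℝ) (B : Matrix (Fin d) (Fin m) ℝ) (ε t : ℝ) :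
    Matrix (Fin d) (Fin d) ℝ :=
  Matrix.of fun i j => ∫ s in (0 : ℝ)..t, gammaIntegrand A B ε s i j

/-- `φ^ε_t(y) = e^{εtA} x + e^{εtA} Γ^ε_t (Γ^ε_1)^{-1} (e^{-εA} y - x)`. -/
def phi (A : Matrix (Fin d) (Fin d) ℝ) (B : Matrix (Fin d) (Fin m) ℝ)
    (x y : EuclideanSpace ℝ (Fin d)) (ε t : ℝ) : EuclideanSpace ℝ (Fin d) :=
  matCLM (NormedSpace.exp ((ε * t) • A)) x +
    matCLM (NormedSpace.exp ((ε * t) • A) * matGamma A B ε t * (matGamma A B ε 1)⁻¹)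
      (matCLM (NormedSpace.exp (-ε • A)) y - x)

lemma continuous_exp_smul (A : Matrix (Fin d) (Fin d) ℝ) {f : ℝ → ℝ} (hf : Continuous f) :
    Continuous fun t : ℝ => NormedSpace.exp (f t • A) := by
  let _ : NormedRing (Matrix (Fin d) (Fin d) ℝ) := Matrix.linftyOpNormedRing
  let _ : NormedAlgebra ℝ (Matrix (Fin d) (Fin d) ℝ) := Matrix.linftyOpNormedAlgebra
  let _ : NormedAlgebra ℚ (Matrix (Fin d) (Fin d) ℝ) := NormedAlgebra.restrictScalars ℚ ℝ _
  exact NormedSpace.exp_continuous.comp (by fun_prop)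

lemma continuous_matGamma (A : Matrix (Fin d) (Fin d) ℝ) (B : Matrix (Fin d) (Fin m) ℝ) (ε : ℝ) :
    Continuous (matGamma A B ε) := by
  have h : Continuous (gammaIntegrand A B ε) := by
    have h1 := continuous_exp_smul A (f := fun s => -(ε * s)) (by fun_prop)
    have h2 := continuous_exp_smul A.transpose (f := fun s => -(ε * s)) (by fun_prop)
    exact ((h1.matrix_mul continuous_const).matrix_mul continuous_const).matrix_mul h2
  refine continuous_matrix fun i j => ?_
  exact intervalIntegral.continuous_primitive
    (fun a b => (h.matrix_elem i j).intervalIntegrable a b) 0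

lemma continuous_matCLM_apply {p q : ℕ} {M : ℝ → Matrix (Fin p) (Fin q) ℝ} (hM : Continuous M)
    (v : EuclideanSpace ℝ (Fin q)) : Continuous fun t => matCLM (M t) v := by
  have h : Continuous fun t => (M t).mulVec v.ofLp := hM.matrix_mulVec continuous_const
  exact (PiLp.continuous_toLp 2 (fun _ : Fin p => ℝ)).comp h

lemma continuous_phi (A : Matrix (Fin d) (Fin d) ℝ) (B : Matrix (Fin d) (Fin m) ℝ)
    (x y : EuclideanSpace ℝ (Fin d)) (ε : ℝ) : Continuous (phi A B x y ε) := by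
  have h1 := continuous_exp_smul A (f := fun t => ε * t) (by fun_prop)
  exact (continuous_matCLM_apply h1 x).add (continuous_matCLM_apply
    ((h1.matrix_mul (continuous_matGamma A B ε)).matrix_mul continuous_const) _)

/-- The rescaling of a path: `z ↦ (ε^{-1/2} D_ε^{-1} (z_t - φ^ε_t(y)))_{t ∈ [0,1]}`, where
`z_t - φ^ε_t(y)` is written in coordinates in the basis `e`. -/
def fluctuation (A : Matrix (Fin d) (Fin d) ℝ) (B : Matrix (Fin d) (Fin m) ℝ)
    (e : OrthonormalBasis (Fin d) ℝ (EuclideanSpace ℝ (Fin d)))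
    (x y : EuclideanSpace ℝ (Fin d)) (ε : ℝ) (z : PathSpace d) : PathSpace d where
  toFun t := (√ε)⁻¹ • matCLM (matD A B ε)⁻¹ (e.repr (z t - phi A B x y ε t))
  continuous_toFun := by
    have h : Continuous fun t : unitInterval => phi A B x y ε t :=
      (continuous_phi A B x y ε).comp continuous_subtype_val
    fun_prop

end LinearAlgebra

/-! ### Brownian motion, the diffusion and its bridges -/

section Probability

variable {d m : ℕ} {Ω : Type*} [MeasurableSpace Ω]

/-- `(W_t)_{t ∈ [0,1]}` is a standard Brownian motion in `ℝ^m` under `P`: it starts from `0`, has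
independent increments, `W_t - W_s` has law `N(0, (t - s) I)`, and almost all paths are
continuous. -/
structure IsBrownianMotion (W : unitInterval → Ω → EuclideanSpace ℝ (Fin m)) (P : Measure Ω) :
    Prop where
  zero : ∀ᵐ ω ∂P, W 0 ω = 0
  indep : HasIndepIncrements W P
  law : ∀ s t : unitInterval, s ≤ t → HasLaw (fun ω => W t ω - W s ω)
    (multivariateGaussian 0 (((t : ℝ) - (s : ℝ)) • (1 : Matrix (Fin m) (Fin m) ℝ))) P
  cont : ∀ᵐ ω ∂P, Continuous fun t => W t ω

/-- `X` is the strong solution on `[0,1]` of `dx_t = εA x_t dt + √ε B dW_t`, `x_0 = x`. As the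
noise is additive, the equation is `x_t = x + ∫_0^t εA x_s ds + √ε B W_t` for all `t`, almost
surely. -/
structure IsDiffusion (A : Matrix (Fin d) (Fin d) ℝ) (B : Matrix (Fin d) (Fin m) ℝ)
    (W : unitInterval → Ω → EuclideanSpace ℝ (Fin m)) (P : Measure Ω)
    (ε : ℝ) (x : EuclideanSpace ℝ (Fin d)) (X : Ω → PathSpace d) : Prop where
  aemeasurable : AEMeasurable X P
  equation : ∀ᵐ ω ∂P, ∀ t : unitInterval,
    X ω t = x + (∫ s in (0 : ℝ)..t, ε • matCLM A (X ω (Set.projIcc 0 1 zero_le_one s))) +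
      √ε • matCLM B (W t ω)

/-- The value at `y` of a Markov kernel, as a probability measure. -/
def kernelLaw (κ : Kernel (EuclideanSpace ℝ (Fin d)) (PathSpace d)) [IsMarkovKernel κ]
    (y : EuclideanSpace ℝ (Fin d)) : ProbabilityMeasure (PathSpace d) :=
  ⟨κ y, inferInstance⟩

/-- The kernel `y ↦ κ y` is the family of bridge laws of `X`: the regular conditional distribution
of the path `X` given its endpoint `X_1 = y`, in the version that depends on `y` continuously with
respect to weak convergence of probability measures on path space. -/
structure IsBridge (X : Ω → PathSpace d) (P : Measure Ω)
    (κ : Kernel (EuclideanSpace ℝ (Fin d)) (PathSpace d)) [IsMarkovKernel κ] : Prop where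
  condDistrib : HasCondDistrib X (fun ω => X ω 1) κ P
  continuous : Continuous (kernelLaw κ)

/-! ### The Wiener integral of a deterministic integrand -/

/-- An operator-valued step function on `[0,t]`: a partition `0 = p_0 ≤ p_1 ≤ … ≤ p_N = t` and a
value `c_i` on each interval `(p_i, p_{i+1}]`. -/
structure StepFunction (d m : ℕ) (t : unitInterval) where
  N : ℕ
  p : ℕ → unitInterval
  mono : Monotone p
  p_zero : p 0 = 0
  p_last : p N = t
  c : ℕ → (EuclideanSpace ℝ (Fin m) →L[ℝ] EuclideanSpace ℝ (Fin d))

/-- The step function as a function of time. -/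
def StepFunction.toFun {t : unitInterval} (g : StepFunction d m t) (s : ℝ) :
    EuclideanSpace ℝ (Fin m) →L[ℝ] EuclideanSpace ℝ (Fin d) :=
  ∑ i ∈ Finset.range g.N,
    (Set.Ioc (g.p i : ℝ) (g.p (i + 1) : ℝ)).indicator (fun _ => g.c i) s

/-- The integral `∑_i c_i (W_{p_{i+1}} - W_{p_i})` of a step function against `W`. -/
def StepFunction.integral {t : unitInterval} (g : StepFunction d m t)
    (W : unitInterval → Ω → EuclideanSpace ℝ (Fin m)) (ω : Ω) : EuclideanSpace ℝ (Fin d) :=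
  ∑ i ∈ Finset.range g.N, g.c i (W (g.p (i + 1)) ω - W (g.p i) ω)

/-- `Y = ∫_0^t f(s) dW_s` (Wiener integral): `Y` is the limit in `L²(P)` of the integrals of step
functions that converge to `f` in `L²([0,t])`. By the Itô isometry this determines `Y` up to a
null set. -/
def IsWienerIntegral (W : unitInterval → Ω → EuclideanSpace ℝ (Fin m)) (P : Measure Ω)
    (t : unitInterval) (f : ℝ → (EuclideanSpace ℝ (Fin m) →L[ℝ] EuclideanSpace ℝ (Fin d)))
    (Y : Ω → EuclideanSpace ℝ (Fin d)) : Prop :=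
  AEStronglyMeasurable Y P ∧ ∃ g : ℕ → StepFunction d m t,
    Tendsto (fun k => ∫⁻ s in Set.Ioc (0 : ℝ) t, ‖f s - (g k).toFun s‖ₑ ^ 2) atTop (𝓝 0) ∧
    Tendsto (fun k => eLpNorm (fun ω => Y ω - (g k).integral W ω) 2 P) atTop (𝓝 0)

end Probability

end KalmanBridge

end

noncomputable section

set_option linter.unusedSectionVars false

namespace KalmanBridge

/-! ### One-parameter groups of operators -/

section Flow

variable {E F : Type*} [NormedAddCommGroup E] [NormedSpace ℝ E] [CompleteSpace E]
  [NormedAddCommGroup F] [NormedSpace ℝ F] [CompleteSpace F]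

/-! The rescaling is an exact change of coordinates. Put `T = ε^{-1/2} D_ε^{-1} e^*` and `a_ε = ε
D_ε^{-1} A D_ε`, written in the basis `e`. Since `A E_k ⊆ E_{k+1}`, the matrix of `A` is block
Hessenberg, so no negative power of `ε` survives in `a_ε`, and `a_ε` is polynomial in `ε`
(`scaledCoord_intertwine`). Since `B` takes values in `E_1`, where `D_ε` is the identity, `T √ε B`
is the coefficient `b` of `B` in the basis `e`, free of `ε` (`scaledCoord_comp_noise`). Hence the
fluctuations are, without remainder, the bridge from `0` to `0` of `dx = a_ε x dt + b dW`
(`fluctuation_add_bridgeMean`). This is why `x` and `y` disappear.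

After an integration by parts this bridge is a continuous linear functional `bridgeMap a b` of the
driving path: the solution minus its regression on the endpoint. It is continuous in `a` wherever
the Gramian is invertible. At `ε = 0` only the subdiagonal blocks remain, and `(a_0, b)` is still
controllable (`isControllable_scaledGenerator_zero`). All fluctuations can therefore be realised on
one Brownian path, where they converge uniformly for every `ω`; weak convergence follows by
dominated convergence.

The limit is explicit because `e^{r a_0} b = Û(r)` (`flow_scaledGenerator_zero`), while Beta
integrals give `e^{t a_0} Γ_t = J_t V J_t`, and `V` at `t = 1` (`matCLM_matJ_mul_matV_mul_matJ`).
The regression coefficient is thus `J_t V J_t V^{-1}`, and `V` is invertible as a product of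
invertible operators.

That the functional is the bridge is Gaussian regression: the solution minus its regression is
uncorrelated with the endpoint, hence independent of it, so the conditional law is a fixed law
shifted by the conditional mean. The endpoint law has full support, so a weakly continuous version
is unique (`IsBridge.unique`). Covariances come from duality on path space, with no stochastic
integral; Wiener integrals enter only to identify the limit. -/

/-- The operator `e^{sa}`. -/
def flow (a : E →L[ℝ] E) (s : ℝ) : E →L[ℝ] E := NormedSpace.exp (s • a)

@[simp]
lemma flow_zero (a : E →L[ℝ] E) : flow a 0 = 1 := by simp [flow]

lemma flow_add (a : E →L[ℝ] E) (s t : ℝ) : flow a (s + t) = flow a s * flow a t := by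
  let _ : NormedAlgebra ℚ (E →L[ℝ] E) := NormedAlgebra.restrictScalars ℚ ℝ _
  rw [flow, add_smul, NormedSpace.exp_add_of_commute]
  · rfl
  · exact ((Commute.refl a).smul_left s).smul_right t

lemma flow_mul_flow_neg (a : E →L[ℝ] E) (s : ℝ) : flow a s * flow a (-s) = 1 := by
  rw [← flow_add, add_neg_cancel, flow_zero]

lemma flow_neg_mul_flow (a : E →L[ℝ] E) (s : ℝ) : flow a (-s) * flow a s = 1 := by
  rw [← flow_add, neg_add_cancel, flow_zero]

lemma isUnit_flow (a : E →L[ℝ] E) (s : ℝ) : IsUnit (flow a s) :=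
  ⟨⟨flow a s, flow a (-s), flow_mul_flow_neg a s, flow_neg_mul_flow a s⟩, rfl⟩

lemma flow_smul (a : E →L[ℝ] E) (c s : ℝ) : flow (c • a) s = flow a (c * s) := by
  rw [flow, flow, smul_smul, mul_comm]

lemma continuous_flow_uncurry : Continuous fun p : (E →L[ℝ] E) × ℝ => flow p.1 p.2 := by
  let _ : NormedAlgebra ℚ (E →L[ℝ] E) := NormedAlgebra.restrictScalars ℚ ℝ _
  exact NormedSpace.exp_continuous.comp (by fun_prop)

@[fun_prop]
lemma Continuous.flow {X : Type*} [TopologicalSpace X] {f : X → (E →L[ℝ] E)} {g : X → ℝ}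
    (hf : Continuous f) (hg : Continuous g) :
    Continuous fun x => KalmanBridge.flow (f x) (g x) :=
  continuous_flow_uncurry.comp (hf.prodMk hg)

lemma hasDerivAt_flow (a : E →L[ℝ] E) (s : ℝ) : HasDerivAt (flow a) (flow a s * a) s :=
  hasDerivAt_exp_smul_const a s

lemma hasSum_flow (a : E →L[ℝ] E) (s : ℝ) :
    HasSum (fun n : ℕ => (s ^ n / n.factorial) • a ^ n) (flow a s) := by
  have := NormedSpace.exp_series_hasSum_exp' (𝕂 := ℝ) (s • a)
  refine this.congr_fun fun n => ?_
  rw [smul_pow, smul_smul, div_eq_inv_mul]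

lemma comp_pow_of_intertwine {T : E →L[ℝ] F} {a : E →L[ℝ] E} {a' : F →L[ℝ] F}
    (h : T ∘L a = a' ∘L T) (n : ℕ) : T ∘L (a ^ n) = (a' ^ n) ∘L T := by
  induction n with
  | zero => ext; simp
  | succ n ih =>
    rw [pow_succ, pow_succ, ContinuousLinearMap.mul_def, ContinuousLinearMap.mul_def,
      ← ContinuousLinearMap.comp_assoc, ih, ContinuousLinearMap.comp_assoc, h,
      ContinuousLinearMap.comp_assoc]

/-- Term by term in the exponential series. Every later change of coordinates rests on this
relation. -/
lemma comp_flow_of_intertwine {T : E →L[ℝ] F} {a : E →L[ℝ] E} {a' : F →L[ℝ] F}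
    (h : T ∘L a = a' ∘L T) (s : ℝ) : T ∘L flow a s = flow a' s ∘L T := by
  have h1 := (hasSum_flow a s).mapL (ContinuousLinearMap.compL ℝ E E F T)
  have h2 := (hasSum_flow a' s).mapL ((ContinuousLinearMap.compL ℝ E F F).flip T)
  refine h1.unique (h2.congr_fun fun n => ?_)
  simp [comp_pow_of_intertwine h n]

end Flow

/-! ### Linear equations driven by a continuous path -/

section Path

variable {E H : Type*} [NormedAddCommGroup E] [NormedSpace ℝ E] [CompleteSpace E]
  [NormedAddCommGroup H] [NormedSpace ℝ H]

/-- The extension of a path on `[0,1]` to `ℝ` that is constant outside `[0,1]`. -/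
def extend (w : C(unitInterval, H)) (s : ℝ) : H := w (Set.projIcc 0 1 zero_le_one s)

@[simp]
lemma extend_coe (w : C(unitInterval, H)) (t : unitInterval) : extend w t = w t := by
  simp [extend, Set.projIcc_val]

lemma extend_of_mem (w : C(unitInterval, H)) {s : ℝ} (hs : s ∈ Set.Icc (0 : ℝ) 1) :
    extend w s = w ⟨s, hs⟩ := by
  simp [extend, Set.projIcc_of_mem _ hs]

lemma continuous_extend_uncurry :
    Continuous fun p : C(unitInterval, H) × ℝ => extend p.1 p.2 :=
  continuous_eval.comp (continuous_fst.prodMk ((continuous_projIcc (h := zero_le_one)).comp continuous_snd))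

@[fun_prop]
lemma Continuous.extend {X : Type*} [TopologicalSpace X] {f : X → C(unitInterval, H)} {g : X → ℝ}
    (hf : Continuous f) (hg : Continuous g) :
    Continuous fun x => KalmanBridge.extend (f x) (g x) :=
  continuous_extend_uncurry.comp (hf.prodMk hg)

lemma norm_extend_le (w : C(unitInterval, H)) (s : ℝ) : ‖extend w s‖ ≤ ‖w‖ :=
  w.norm_coe_le_norm _

/-- `b w_t + ∫_0^t e^{(t-s)a} a b w_s ds`. -/
def linearResponseFun (a : E →L[ℝ] E) (b : H →L[ℝ] E) (w : C(unitInterval, H))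
    (t : ℝ) : E :=
  b (extend w t) + ∫ s in (0 : ℝ)..t, flow a (t - s) (a (b (extend w s)))

/-- Joint continuity serves three times: in `t` for the path itself, in `(w, t)` for continuity of
the operator, in `(a, t)` for the passage to the limit in the generator. -/
lemma continuous_linearResponseFun (b : H →L[ℝ] E) :
    Continuous fun p : ((E →L[ℝ] E) × C(unitInterval, H)) × ℝ =>
      linearResponseFun p.1.1 b p.1.2 p.2 := by
  unfold linearResponseFun
  refine Continuous.add (by fun_prop) ?_
  refine intervalIntegral.continuous_parametric_intervalIntegral_of_continuous
    (f := fun (p : ((E →L[ℝ] E) × C(unitInterval, H)) × ℝ) s =>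
      flow p.1.1 (p.2 - s) (p.1.1 (b (extend p.1.2 s)))) ?_ continuous_snd
  unfold Function.uncurry
  fun_prop

/-- The solution started at `0` of `dx = a x dt + b dw`, as an operator on driving paths. -/
def linearResponse (a : E →L[ℝ] E) (b : H →L[ℝ] E) :
    C(unitInterval, H) →L[ℝ] C(unitInterval, E) where
  toFun w := ⟨fun t => linearResponseFun a b w t,
    (continuous_linearResponseFun b).comp
      (continuous_const (y := (a, w)) |>.prodMk continuous_subtype_val)⟩
  map_add' w w' := by
    ext t
    simp only [ContinuousMap.coe_mk, ContinuousMap.add_apply, linearResponseFun]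
    have h (v : C(unitInterval, H)) : IntervalIntegrable
        (fun s => flow a (t - s) (a (b (extend v s)))) volume 0 t :=
      Continuous.intervalIntegrable (by fun_prop) _ _
    rw [add_add_add_comm, ← intervalIntegral.integral_add (h w) (h w')]
    simp [extend]
  map_smul' c w := by
    ext t
    simp [linearResponseFun, extend, ← intervalIntegral.integral_smul]
  cont := by
    -- Currying a jointly continuous map gives continuity into path space for the compact-open
    -- topology, that is, for uniform convergence.
    let f : C(C(unitInterval, H) × unitInterval, E) :=
      ⟨fun p => linearResponseFun a b p.1 p.2, (continuous_linearResponseFun b).comp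
        ((continuous_const.prodMk continuous_fst).prodMk
          (continuous_subtype_val.comp continuous_snd))⟩
    exact f.curry.continuous

lemma linearResponse_apply (a : E →L[ℝ] E) (b : H →L[ℝ] E) (w : C(unitInterval, H))
    (t : unitInterval) : linearResponse a b w t = linearResponseFun a b w t := rfl

lemma continuous_linearResponse (b : H →L[ℝ] E) (w : C(unitInterval, H)) :
    Continuous fun a => linearResponse a b w := by
  let f : C((E →L[ℝ] E) × unitInterval, E) :=
    ⟨fun p => linearResponseFun p.1 b w p.2, (continuous_linearResponseFun b).comp
      ((continuous_fst.prodMk continuous_const).prodMk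
        (continuous_subtype_val.comp continuous_snd))⟩
  exact f.curry.continuous

lemma comp_linearResponse {F : Type*} [NormedAddCommGroup F] [NormedSpace ℝ F] [CompleteSpace F]
    {T : E →L[ℝ] F} {a : E →L[ℝ] E} {a' : F →L[ℝ] F} (h : T ∘L a = a' ∘L T) (b : H →L[ℝ] E)
    (w : C(unitInterval, H)) (t : unitInterval) :
    T (linearResponse a b w t) = linearResponse a' (T ∘L b) w t := by
  simp only [linearResponse_apply, linearResponseFun, map_add]
  rw [← T.intervalIntegral_comp_comm (Continuous.intervalIntegrable (by fun_prop) _ _)]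
  congr 1
  refine intervalIntegral.integral_congr fun s _ => ?_
  have h1 (y : E) : T (flow a (t - s) y) = flow a' (t - s) (T y) :=
    DFunLike.congr_fun (comp_flow_of_intertwine h (t - s)) y
  have h2 (y : E) : T (a y) = a' (T y) := DFunLike.congr_fun h y
  simp [h1, h2]

/-- Variation of constants. -/
lemma eq_linearResponse_of_integral_equation {a : E →L[ℝ] E} {b : H →L[ℝ] E}
    {w : C(unitInterval, H)} {x : E} {X : C(unitInterval, E)}
    (hX : ∀ t : unitInterval, X t = x + (∫ s in (0 : ℝ)..t, a (extend X s)) + b (w t))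
    (t : unitInterval) : X t = flow a t x + linearResponse a b w t := by
  -- `X` need not be differentiable, but `x + v = X - b w` is. The derivative of `e^{(t-s)a} (x +
  -- v_s)` is `e^{(t-s)a} a b w_s`, and integrating it gives the formula.
  set v : ℝ → E := fun r => ∫ s in (0 : ℝ)..r, a (extend X s) with hv
  have hv' (r : ℝ) : HasDerivAt v (a (extend X r)) r :=
    intervalIntegral.integral_hasDerivAt_right
      (Continuous.intervalIntegrable (by fun_prop) _ _)
      (Continuous.stronglyMeasurableAtFilter (by fun_prop) _ _)
      (Continuous.continuousAt (by fun_prop))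
  have hext : ∀ r ∈ Set.Icc (0 : ℝ) 1, extend X r = x + v r + b (extend w r) := fun r hr => by
    rw [extend_of_mem _ hr, extend_of_mem _ hr, hX ⟨r, hr⟩]
  have hd (r : ℝ) : HasDerivAt (fun s => flow a (t - s) (x + v s))
      (flow a (t - r) (a (extend X r)) - flow a (t - r) (a (x + v r))) r := by
    have h1 : HasDerivAt (fun s => flow a (t - s)) (-(flow a (t - r) * a)) r := by
      have := (hasDerivAt_flow a (t - r)).scomp r ((hasDerivAt_id r).const_sub (t : ℝ))
      rwa [neg_smul, one_smul] at this
    have h2 := h1.clm_apply ((hv' r).const_add x)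
    convert h2 using 1
    simp [sub_eq_neg_add]
  have hd' : ∀ r ∈ Set.uIcc (0 : ℝ) t, HasDerivAt (fun s => flow a (t - s) (x + v s))
      (flow a (t - r) (a (b (extend w r)))) r := fun r hr => by
    rw [Set.uIcc_of_le t.2.1] at hr
    convert hd r using 1
    rw [hext r ⟨hr.1, hr.2.trans t.2.2⟩, ← map_sub, ← map_sub, add_sub_cancel_left]
  have := intervalIntegral.integral_eq_sub_of_hasDerivAt hd'
    (Continuous.intervalIntegrable (by fun_prop) _ _)
  rw [hX t, linearResponse_apply, linearResponseFun, this]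
  simp only [hv, sub_self, flow_zero, one_apply_eq_self, sub_zero,
    intervalIntegral.integral_same, add_zero, extend_coe]
  abel

end Path

/-! ### Controllability Gramian and bridges as operators on driving paths -/

section Gramian

open scoped InnerProductSpace

variable {E F H : Type*} [NormedAddCommGroup E] [InnerProductSpace ℝ E] [CompleteSpace E]
  [NormedAddCommGroup F] [InnerProductSpace ℝ F] [CompleteSpace F]
  [NormedAddCommGroup H] [InnerProductSpace ℝ H] [CompleteSpace H]

/-- `∫_0^t e^{-sa} b b^* e^{-sa^*} ds`. -/
def gramian (a : E →L[ℝ] E) (b : H →L[ℝ] E) (t : ℝ) : E →L[ℝ] E :=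
  ∫ s in (0 : ℝ)..t, (flow a (-s) ∘L b) ∘L (flow a (-s) ∘L b).adjoint

@[fun_prop]
lemma Continuous.adjoint {X : Type*} [TopologicalSpace X] {f : X → (E →L[ℝ] F)}
    (hf : Continuous f) : Continuous fun x => (f x).adjoint :=
  (ContinuousLinearMap.adjoint (𝕜 := ℝ) (E := E) (F := F)).continuous.comp hf

lemma continuous_gramian_uncurry (b : H →L[ℝ] E) :
    Continuous fun p : (E →L[ℝ] E) × ℝ => gramian p.1 b p.2 := by
  unfold gramian
  refine intervalIntegral.continuous_parametric_intervalIntegral_of_continuous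
    (f := fun (p : (E →L[ℝ] E) × ℝ) s =>
      (flow p.1 (-s) ∘L b) ∘L (flow p.1 (-s) ∘L b).adjoint) ?_ continuous_snd
  unfold Function.uncurry
  fun_prop

lemma inner_gramian (a : E →L[ℝ] E) (b : H →L[ℝ] E) (t : ℝ) (u v : E) :
    ⟪u, gramian a b t v⟫_ℝ = ∫ s in (0 : ℝ)..t,
      ⟪(flow a (-s) ∘L b).adjoint u, (flow a (-s) ∘L b).adjoint v⟫_ℝ := by
  have hc : Continuous fun s => (flow a (-s) ∘L b) ∘L (flow a (-s) ∘L b).adjoint := by fun_prop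
  have h := ((innerSL ℝ u) ∘L (ContinuousLinearMap.apply ℝ E v)).intervalIntegral_comp_comm
    (hc.intervalIntegrable (μ := volume) 0 t)
  simp only [ContinuousLinearMap.comp_apply, innerSL_apply_apply,
    ContinuousLinearMap.apply_apply] at h
  rw [gramian, ← h]
  refine intervalIntegral.integral_congr fun s _ => ?_
  rw [ContinuousLinearMap.adjoint_inner_left]
  simp

/-- The Gramian transforms like a covariance. -/
lemma comp_gramian_of_intertwine {T : E →L[ℝ] F} {a : E →L[ℝ] E} {a' : F →L[ℝ] F}
    (h : T ∘L a = a' ∘L T) (b : H →L[ℝ] E) (t : ℝ) :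
    T ∘L gramian a b t ∘L T.adjoint = gramian a' (T ∘L b) t := by
  ext v
  refine ext_inner_left ℝ fun u => ?_
  rw [ContinuousLinearMap.comp_apply, ContinuousLinearMap.comp_apply,
    ← ContinuousLinearMap.adjoint_inner_left, inner_gramian, inner_gramian]
  refine intervalIntegral.integral_congr fun s _ => ?_
  have : flow a' (-s) ∘L T ∘L b = T ∘L flow a (-s) ∘L b := by
    rw [← ContinuousLinearMap.comp_assoc, ← comp_flow_of_intertwine h,
      ContinuousLinearMap.comp_assoc]
  simp only [this]
  rw [ContinuousLinearMap.adjoint_comp T]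
  simp

/-- The Kalman condition in dual form: no nonzero vector is orthogonal to all `a^k b v`. -/
def IsControllable (a : E →L[ℝ] E) (b : H →L[ℝ] E) : Prop :=
  ∀ x : E, (∀ (k : ℕ) (v : H), ⟪x, (a ^ k) (b v)⟫_ℝ = 0) → x = 0

/-- Surjectivity of `T` makes its adjoint injective. -/
lemma IsControllable.map {T : E →L[ℝ] F} {a : E →L[ℝ] E} {a' : F →L[ℝ] F} {b : H →L[ℝ] E}
    (hab : IsControllable a b) (h : T ∘L a = a' ∘L T) (hT : Function.Surjective T) :
    IsControllable a' (T ∘L b) := by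
  intro x hx
  have h0 : T.adjoint x = 0 := hab _ fun k v => by
    rw [ContinuousLinearMap.adjoint_inner_left, ← hx k v]
    exact congrArg _ (DFunLike.congr_fun (comp_pow_of_intertwine h k) (b v))
  obtain ⟨y, rfl⟩ := hT x
  rw [← inner_self_eq_zero (𝕜 := ℝ), ← ContinuousLinearMap.adjoint_inner_left, h0, inner_zero_left]

lemma IsControllable.smul {a : E →L[ℝ] E} {b : H →L[ℝ] E} (hab : IsControllable a b) {c c' : ℝ}
    (hc : c ≠ 0) (hc' : c' ≠ 0) : IsControllable (c • a) (c' • b) := by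
  intro x hx
  refine hab x fun k v => ?_
  have := hx k v
  simpa [smul_pow, inner_smul_right, hc, hc'] using this

/-- For `x` in the kernel the quadratic form is the integral of `‖(e^{-sa} b)^* x‖²`, so `⟪x,
e^{-sa} b v⟫` vanishes on `(0,1)`. Differentiating `k` times and letting `s → 0` gives `⟪x, a^k b v⟫
= 0`. -/
lemma IsControllable.isUnit_gramian [FiniteDimensional ℝ E] {a : E →L[ℝ] E} {b : H →L[ℝ] E}
    (hab : IsControllable a b) : IsUnit (gramian a b 1) := by
  have hinj : Function.Injective (gramian a b 1) := by
    rw [injective_iff_map_eq_zero]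
    intro x hx
    have h0 : ∫ s in (0 : ℝ)..1, ‖(flow a (-s) ∘L b).adjoint x‖ ^ 2 = 0 := by
      simp_rw [← real_inner_self_eq_norm_sq]
      rw [← inner_gramian, hx, inner_zero_right]
    have hc : Continuous fun s => ‖(flow a (-s) ∘L b).adjoint x‖ ^ 2 := by fun_prop
    have hz : ∀ s ∈ Set.Ioo (0 : ℝ) 1, (flow a (-s) ∘L b).adjoint x = 0 := by
      intro s hs
      by_contra hne
      have hpos : 0 < ∫ s in (0 : ℝ)..1, ‖(flow a (-s) ∘L b).adjoint x‖ ^ 2 :=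
        intervalIntegral.integral_pos zero_lt_one hc.continuousOn (fun _ _ => by positivity)
          ⟨s, ⟨hs.1.le, hs.2.le⟩, by positivity⟩
      exact hpos.ne' h0
    have hk (k : ℕ) (v : H) : ∀ s ∈ Set.Ioo (0 : ℝ) 1,
        ⟪x, flow a (-s) ((a ^ k) (b v))⟫_ℝ = 0 := by
      induction k with
      | zero =>
        intro s hs
        have := ContinuousLinearMap.adjoint_inner_left (flow a (-s) ∘L b) v x
        rw [hz s hs, inner_zero_left] at this
        simpa using this.symm
      | succ k ih =>
        intro s hs
        have h1 : HasDerivAt (fun s => ⟪x, flow a (-s) ((a ^ k) (b v))⟫_ℝ)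
            (-⟪x, flow a (-s) ((a ^ (k + 1)) (b v))⟫_ℝ) s := by
          have h2 := (hasDerivAt_flow a (-s)).scomp s (hasDerivAt_neg s)
          rw [neg_smul, one_smul] at h2
          have h3 := ((innerSL ℝ x) ∘L
            (ContinuousLinearMap.apply ℝ E ((a ^ k) (b v)))).hasFDerivAt.comp_hasDerivAt s h2
          exact h3.congr_deriv (by simp [pow_succ'])
        have h4 : (fun s => ⟪x, flow a (-s) ((a ^ k) (b v))⟫_ℝ) =ᶠ[𝓝 s] fun _ => 0 :=
          Filter.eventually_of_mem (isOpen_Ioo.mem_nhds hs) ih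
        have h5 := h1.unique ((hasDerivAt_const s (0 : ℝ)).congr_of_eventuallyEq h4)
        linarith
    refine hab x fun k v => ?_
    have hcl : Set.Icc (0 : ℝ) 1 ⊆ {s | ⟪x, flow a (-s) ((a ^ k) (b v))⟫_ℝ = 0} := by
      rw [← closure_Ioo zero_ne_one]
      exact closure_minimal (hk k v) (isClosed_eq (by fun_prop) continuous_const)
    simpa using hcl (Set.left_mem_Icc.2 zero_le_one)
  rw [ContinuousLinearMap.isUnit_iff_bijective]
  exact ⟨hinj, (LinearMap.injective_iff_surjective (f := (gramian a b 1 : E →ₗ[ℝ] E))).1 hinj⟩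

/-- The regression coefficient of the value at time `t` on the value at time `1`. -/
def regression (a : E →L[ℝ] E) (b : H →L[ℝ] E) (t : ℝ) : E →L[ℝ] E :=
  flow a t * gramian a b t * Ring.inverse (gramian a b 1) * flow a (-1)

/-- The normal equation `R_t Cov(x_1, x_1) = Cov(x_t, x_1)` of the regression, with the common right
factor `(e^a)^*` removed. -/
lemma regression_mul {a : E →L[ℝ] E} {b : H →L[ℝ] E} (h : IsUnit (gramian a b 1)) (t : ℝ) :
    regression a b t * (flow a 1 * gramian a b 1) = flow a t * gramian a b t := by
  rw [regression, mul_assoc, ← mul_assoc (flow a (-1)), flow_neg_mul_flow, one_mul, mul_assoc,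
    Ring.inverse_mul_cancel _ h, mul_one]

lemma continuous_regression (a : E →L[ℝ] E) (b : H →L[ℝ] E) : Continuous (regression a b) := by
  have h := (continuous_gramian_uncurry b).comp (Continuous.prodMk_right a)
  exact (((continuous_flow_uncurry.comp (Continuous.prodMk_right a)).mul h).mul
    continuous_const).mul continuous_const

/-- From `Γ' = T Γ T^*` one gets `T^* Γ'^{-1} T = Γ^{-1}` by cancelling the injective `T` on the
left, so no inverse of `T` has to be written. -/
lemma regression_intertwine {T : E →L[ℝ] F} {a : E →L[ℝ] E} {a' : F →L[ℝ] F}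
    (h : T ∘L a = a' ∘L T) (hT : Function.Injective T) {b : H →L[ℝ] E}
    (hu : IsUnit (gramian a b 1)) (hu' : IsUnit (gramian a' (T ∘L b) 1)) (t : ℝ) :
    regression a' (T ∘L b) t ∘L T = T ∘L regression a b t := by
  have key : T.adjoint ∘L Ring.inverse (gramian a' (T ∘L b) 1) ∘L T = Ring.inverse (gramian a b 1) := by
    have h1 : gramian a b 1 * (T.adjoint ∘L Ring.inverse (gramian a' (T ∘L b) 1) ∘L T) = 1 := by
      ext x
      apply hT
      have h2 : T ∘L gramian a b 1 ∘L T.adjoint ∘L Ring.inverse (gramian a' (T ∘L b) 1) ∘L T = T := by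
        have h3 := comp_gramian_of_intertwine h b 1
        calc _ = (T ∘L gramian a b 1 ∘L T.adjoint) ∘L Ring.inverse (gramian a' (T ∘L b) 1) ∘L T := by
              simp only [ContinuousLinearMap.comp_assoc]
          _ = (gramian a' (T ∘L b) 1 * Ring.inverse (gramian a' (T ∘L b) 1)) ∘L T := by
              rw [h3, ContinuousLinearMap.mul_def, ContinuousLinearMap.comp_assoc]
          _ = T := by
              rw [Ring.mul_inverse_cancel _ hu']
              ext; simp
      exact DFunLike.congr_fun h2 x
    rw [← one_mul (T.adjoint ∘L _), ← Ring.inverse_mul_cancel _ hu, mul_assoc, h1, mul_one]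
  have hf (s : ℝ) := comp_flow_of_intertwine h s
  simp only [regression, ContinuousLinearMap.mul_def]
  rw [← comp_gramian_of_intertwine h b t, ← key]
  simp only [ContinuousLinearMap.comp_assoc]
  rw [← hf (-1), ← ContinuousLinearMap.comp_assoc (flow a' t), ← hf t]
  simp only [ContinuousLinearMap.comp_assoc]

/-- Pointwise application of a path of operators. -/
def applyPath (R : C(unitInterval, E →L[ℝ] F)) (x : E) : C(unitInterval, F) where
  toFun t := R t x

lemma continuous_applyPath : Continuous fun p : C(unitInterval, E →L[ℝ] F) × E =>
    applyPath p.1 p.2 := by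
  let f : C((C(unitInterval, E →L[ℝ] F) × E) × unitInterval, F) :=
    ⟨fun p => p.1.1 p.2 p.1.2, by fun_prop⟩
  exact f.curry.continuous

/-- The path of regression coefficients. -/
def regressionPath (a : E →L[ℝ] E) (b : H →L[ℝ] E) : C(unitInterval, E →L[ℝ] E) where
  toFun t := regression a b t
  continuous_toFun := (continuous_regression a b).comp continuous_subtype_val

@[simp]
lemma applyPath_regressionPath (a : E →L[ℝ] E) (b : H →L[ℝ] E) (x : E) (t : unitInterval) :
    applyPath (regressionPath a b) x t = regression a b t x := rfl

/-- Inversion is continuous at units, hence continuity only at generators with invertible Gramian.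
This is where controllability of the limiting system enters the convergence. -/
lemma continuousAt_regressionPath {a : E →L[ℝ] E} {b : H →L[ℝ] E}
    (h : IsUnit (gramian a b 1)) : ContinuousAt (fun a' => regressionPath a' b) a := by
  let f : C((E →L[ℝ] E) × unitInterval, E →L[ℝ] E) :=
    ⟨fun p => flow p.1 p.2 * gramian p.1 b p.2, (by fun_prop : Continuous fun p :
      (E →L[ℝ] E) × unitInterval => flow p.1 p.2).mul ((continuous_gramian_uncurry b).comp
        (continuous_fst.prodMk (continuous_subtype_val.comp continuous_snd)))⟩
  have h1 : ContinuousAt (fun a' => f.curry a') a := f.curry.continuous.continuousAt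
  have h2 : ContinuousAt (fun a' => Ring.inverse (gramian a' b 1)) a := by
    obtain ⟨u, hu⟩ := h
    have h3 := NormedRing.inverse_continuousAt u
    rw [hu] at h3
    exact ContinuousAt.comp (f := fun a' => gramian a' b 1) (g := Ring.inverse) h3
      ((continuous_gramian_uncurry b).comp (Continuous.prodMk_left (1 : ℝ))).continuousAt
  have h4 : ContinuousAt (fun a' => Ring.inverse (gramian a' b 1) * flow a' (-1)) a :=
    h2.mul (by fun_prop : Continuous fun a' : E →L[ℝ] E => flow a' (-1)).continuousAt
  have h5 : ContinuousAt (fun a' => f.curry a' *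
      ContinuousMap.const unitInterval (Ring.inverse (gramian a' b 1) * flow a' (-1))) a :=
    h1.mul (ContinuousMap.continuous_const'.continuousAt.comp h4)
  exact h5

/-- The bridge from `0` to `0` over `[0,1]` of `dx = a x dt + b dw`: the solution minus its
regression on the endpoint. -/
def bridgeMap (a : E →L[ℝ] E) (b : H →L[ℝ] E) : C(unitInterval, H) →L[ℝ] C(unitInterval, E) where
  toFun w := linearResponse a b w - applyPath (regressionPath a b) (linearResponse a b w 1)
  map_add' w w' := by
    ext t
    simp only [map_add, ContinuousMap.add_apply, ContinuousMap.sub_apply, applyPath_regressionPath]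
    abel
  map_smul' c w := by
    ext t
    simp [smul_sub]
  cont := (linearResponse a b).continuous.sub (continuous_applyPath.comp
    (continuous_const.prodMk
      ((continuous_eval_const 1).comp (linearResponse a b).continuous)))

lemma bridgeMap_apply (a : E →L[ℝ] E) (b : H →L[ℝ] E) (w : C(unitInterval, H))
    (t : unitInterval) : bridgeMap a b w t =
      linearResponse a b w t - regression a b t (linearResponse a b w 1) := rfl

lemma continuousAt_bridgeMap {a : E →L[ℝ] E} {b : H →L[ℝ] E}
    (h : IsUnit (gramian a b 1)) (w : C(unitInterval, H)) :
    ContinuousAt (fun a' => bridgeMap a' b w) a := by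
  have h1 := (continuous_linearResponse b w).continuousAt (x := a)
  have h2 : ContinuousAt (fun a' => linearResponse a' b w 1) a :=
    (continuous_eval_const 1).continuousAt.comp h1
  exact h1.sub (continuous_applyPath.continuousAt.comp
    ((continuousAt_regressionPath h).prodMk h2))

/-- Both the solution and its regression are covariant under changes of coordinates. This makes the
rescaling exact, path by path. -/
lemma comp_bridgeMap {T : E →L[ℝ] F} {a : E →L[ℝ] E} {a' : F →L[ℝ] F}
    (h : T ∘L a = a' ∘L T) (hT : Function.Injective T) {b : H →L[ℝ] E}
    (hu : IsUnit (gramian a b 1)) (hu' : IsUnit (gramian a' (T ∘L b) 1))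
    (w : C(unitInterval, H)) (t : unitInterval) :
    T (bridgeMap a b w t) = bridgeMap a' (T ∘L b) w t := by
  rw [bridgeMap_apply, bridgeMap_apply, map_sub, ← comp_linearResponse h, ← comp_linearResponse h]
  congr 1
  exact (DFunLike.congr_fun (regression_intertwine h hT hu hu' t) _).symm

end Gramian

/-! ### Brownian motion as a Gaussian random element of path space -/

section GaussianLimit

variable {Ω : Type*} [MeasurableSpace Ω] {P : Measure Ω}

/-- Almost sure limits of centered Gaussian variables are centered Gaussian. -/
lemma exists_map_eq_gaussianReal_of_tendsto_ae [IsProbabilityMeasure P] {X : ℕ → Ω → ℝ} {Y : Ω → ℝ}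
    (hX : ∀ n, HasGaussianLaw (X n) P) (h0 : ∀ n, ∫ ω, X n ω ∂P = 0)
    (hlim : ∀ᵐ ω ∂P, Tendsto (fun n => X n ω) atTop (𝓝 (Y ω))) :
    ∃ v : NNReal, P.map Y = gaussianReal 0 v := by
  have hXm (n : ℕ) : AEMeasurable (X n) P := (hX n).aemeasurable
  have hYm : AEMeasurable Y P := aemeasurable_of_tendsto_metrizable_ae atTop hXm hlim
  have : IsProbabilityMeasure (P.map Y) := Measure.isProbabilityMeasure_map hYm
  have hchar {Z : Ω → ℝ} (hZ : AEMeasurable Z P) (t : ℝ) :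
      charFun (P.map Z) t = ∫ ω, Complex.exp (t * Z ω * Complex.I) ∂P := by
    rw [charFun_apply_real, integral_map hZ (by fun_prop)]
  have hconv (t : ℝ) : Tendsto (fun n => charFun (P.map (X n)) t) atTop
      (𝓝 (charFun (P.map Y) t)) := by
    simp_rw [hchar (hXm _), hchar hYm]
    refine tendsto_integral_of_dominated_convergence (fun _ => 1) (fun n => ?_)
      (integrable_const 1) (fun n => ?_) ?_
    · have := hXm n
      exact AEMeasurable.aestronglyMeasurable (by fun_prop)
    · refine .of_forall fun ω => ?_
      rw [← Complex.ofReal_mul, Complex.norm_exp_ofReal_mul_I]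
    · filter_upwards [hlim] with ω hω
      have hcont : Continuous fun z : ℝ => Complex.exp (t * z * Complex.I) := by fun_prop
      exact (hcont.tendsto _).comp hω
  set v : ℕ → ℝ := fun n => (Var[X n; P]).toNNReal with hv
  have hg (n : ℕ) (t : ℝ) :
      charFun (P.map (X n)) t = (Real.exp (-(v n * t ^ 2 / 2)) : ℝ) := by
    rw [(hX n).map_eq_gaussianReal, charFun_gaussianReal, h0 n]
    simp [hv]
  -- One nonzero frequency suffices: if the limiting characteristic function does not vanish there,
  -- the logarithm of its modulus determines the limit `u` of the variances.
  obtain ⟨t, ht, htne⟩ : ∃ t : ℝ, t ≠ 0 ∧ charFun (P.map Y) t ≠ 0 := by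
    have hcont : Continuous (charFun (P.map Y)) := continuous_charFun
    have h1 : ∀ᶠ t in 𝓝[≠] (0 : ℝ), charFun (P.map Y) t ≠ 0 :=
      nhdsWithin_le_nhds (hcont.continuousAt.eventually_ne (by simp))
    obtain ⟨t, h2, h3⟩ := (h1.and self_mem_nhdsWithin).exists
    exact ⟨t, h3, h2⟩
  set u : ℝ := -(2 * Real.log ‖charFun (P.map Y) t‖ / t ^ 2) with hu
  have hvu : Tendsto v atTop (𝓝 u) := by
    have h1 := ((hconv t).norm.log (norm_ne_zero_iff.2 htne))
    have h2 := ((h1.const_mul 2).div_const (t ^ 2)).neg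
    refine h2.congr fun n => ?_
    rw [hg, Complex.norm_real, Real.norm_of_nonneg (Real.exp_pos _).le, Real.log_exp]
    field_simp
  have hu0 : 0 ≤ u := ge_of_tendsto' hvu fun n => by simp [hv]
  refine ⟨u.toNNReal, Measure.ext_of_charFun (funext fun s => ?_)⟩
  have h3 : Tendsto (fun n => ((Real.exp (-(v n * s ^ 2 / 2)) : ℝ) : ℂ)) atTop
      (𝓝 ((Real.exp (-(u * s ^ 2 / 2)) : ℝ) : ℂ)) := by
    have hcont : Continuous fun z : ℝ => ((Real.exp (-(z * s ^ 2 / 2)) : ℝ) : ℂ) := by fun_prop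
    exact (hcont.tendsto u).comp hvu
  have h4 := tendsto_nhds_unique (hconv s) (h3.congr fun n => (hg n s).symm)
  rw [h4, charFun_gaussianReal]
  simp [Real.coe_toNNReal u hu0]

/-! ### From finite-dimensional laws to path space by Bernstein approximation. -/

variable {E : Type*} [NormedAddCommGroup E] [NormedSpace ℝ E]

/-- `x ↦ f • x`, as an operator from vectors to paths. -/
def smulConst (f : C(unitInterval, ℝ)) : E →L[ℝ] C(unitInterval, E) where
  toFun x := f • ContinuousMap.const _ x
  map_add' x y := by ext; simp
  map_smul' c x := by ext; simp [smul_comm c]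
  cont := by
    let g : C(E × unitInterval, E) := ⟨fun p => f p.2 • p.1, by fun_prop⟩
    exact g.curry.continuous

/-- Exhibits the approximant as a linear image of finitely many values of the path. -/
lemma bernsteinApproximation_eq_sum (n : ℕ) (f : C(unitInterval, E)) :
    bernsteinApproximation n f =
      ∑ k : Fin (n + 1), smulConst (bernstein n k) (f (bernstein.z k)) := by
  ext t
  rw [bernsteinApproximation.apply, ContinuousMap.sum_apply]
  rfl

/-- A process with almost surely continuous paths, as a random element of path space. -/
def continuousVersion (W : unitInterval → Ω → E) (ω : Ω) : C(unitInterval, E) :=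
  -- The zero path is a default for discontinuous samples; for Brownian motion these form a null
  -- set.
  open Classical in if h : Continuous fun t => W t ω then ⟨fun t => W t ω, h⟩ else 0

lemma continuousVersion_ae_eq {W : unitInterval → Ω → E}
    (hW : ∀ᵐ ω ∂P, Continuous fun t => W t ω) :
    ∀ᵐ ω ∂P, ∀ t, continuousVersion W ω t = W t ω := by
  filter_upwards [hW] with ω hω t
  simp [continuousVersion, hω]

variable [MeasurableSpace E] [BorelSpace E]
  [MeasurableSpace C(unitInterval, E)] [BorelSpace C(unitInterval, E)]

/-- The Bernstein approximants are measurable functions of finitely many values and converge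
uniformly to the path. -/
lemma aemeasurable_of_eval [SecondCountableTopology E] {Y : Ω → C(unitInterval, E)}
    (h : ∀ t, AEMeasurable (fun ω => Y ω t) P) : AEMeasurable Y P := by
  refine aemeasurable_of_tendsto_metrizable_ae (f := fun n ω => bernsteinApproximation n (Y ω))
    atTop (fun n => ?_) (.of_forall fun ω => bernsteinApproximation_uniform (Y ω))
  simp_rw [bernsteinApproximation_eq_sum]
  exact Finset.aemeasurable_fun_sum _ fun k _ =>
    (smulConst (bernstein n k)).continuous.measurable.comp_aemeasurable (h _)

/-- A functional of a Bernstein approximant is a linear combination of finitely many values, hence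
centered Gaussian, and such laws are closed under almost sure limits. Centering of all functionals
is recorded because later covariances are computed as plain second moments. -/
lemma hasGaussianLaw_of_isGaussianProcess [IsProbabilityMeasure P] [SecondCountableTopology E]
    {Y : Ω → C(unitInterval, E)} [CompleteSpace E]
    (hY : IsGaussianProcess (fun t ω => Y ω t) P) (h0 : ∀ t, ∫ ω, Y ω t ∂P = 0) :
    HasGaussianLaw Y P ∧ ∀ L : C(unitInterval, E) →L[ℝ] ℝ, ∫ ω, L (Y ω) ∂P = 0 := by
  have hm : AEMeasurable Y P := aemeasurable_of_eval hY.aemeasurable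
  have key (L : C(unitInterval, E) →L[ℝ] ℝ) :
      ∃ v : NNReal, P.map (fun ω => L (Y ω)) = gaussianReal 0 v := by
    have hsum (n : ℕ) (ω : Ω) : L (bernsteinApproximation n (Y ω)) =
        ∑ k : Fin (n + 1), (L ∘L smulConst (bernstein n k)) (Y ω (bernstein.z k)) := by
      simp [bernsteinApproximation_eq_sum]
    refine exists_map_eq_gaussianReal_of_tendsto_ae
      (X := fun n ω => L (bernsteinApproximation n (Y ω))) (fun n => ?_) (fun n => ?_)
      (.of_forall fun ω => (L.continuous.tendsto _).comp (bernsteinApproximation_uniform (Y ω)))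
    · simp_rw [hsum]
      have h0 : IsGaussianProcess (fun (k : Fin (n + 1)) ω => Y ω (bernstein.z k)) P :=
        hY.comp_right fun k : Fin (n + 1) => bernstein.z k
      have h1 := h0.comp_left fun k : Fin (n + 1) => L ∘L smulConst (bernstein n k)
      exact h1.hasGaussianLaw_fun_sum (I := Finset.univ)
    · simp_rw [hsum]
      have hi (k : Fin (n + 1)) : Integrable (fun ω => Y ω (bernstein.z k)) P :=
        (hY.hasGaussianLaw_eval _).integrable
      rw [integral_finsetSum _ fun k _ => ContinuousLinearMap.integrable_comp _ (hi k)]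
      refine Finset.sum_eq_zero fun k _ => ?_
      rw [ContinuousLinearMap.integral_comp_comm _ (hi k), h0, map_zero]
  have hmap (L : C(unitInterval, E) →L[ℝ] ℝ) :
      (P.map Y).map L = P.map (fun ω => L (Y ω)) :=
    AEMeasurable.map_map_of_aemeasurable L.continuous.measurable.aemeasurable hm
  refine ⟨⟨?_⟩, fun L => ?_⟩
  · refine isGaussian_of_map_eq_gaussianReal fun L => ?_
    obtain ⟨v, hv⟩ := key L
    exact ⟨0, v, (hmap L).trans hv⟩
  · obtain ⟨v, hv⟩ := key L
    have h1 : ∫ x, x ∂(P.map fun ω => L (Y ω)) = 0 := by rw [hv, integral_id_gaussianReal]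
    rwa [integral_map (φ := fun ω => L (Y ω)) (f := fun x => x)
      (L.continuous.measurable.comp_aemeasurable hm) (by fun_prop)] at h1

end GaussianLimit

/-! ### Gaussian law and covariance of Brownian motion. -/

section Brownian

open scoped InnerProductSpace

variable {m : ℕ} {Ω : Type*} [MeasurableSpace Ω] {P : Measure Ω} [IsProbabilityMeasure P]
  {W : unitInterval → Ω → EuclideanSpace ℝ (Fin m)}

namespace IsBrownianMotion

lemma hasLaw_eval (hW : IsBrownianMotion W P) (t : unitInterval) : HasLaw (W t)
    (multivariateGaussian 0 ((t : ℝ) • (1 : Matrix (Fin m) (Fin m) ℝ))) P := by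
  have h := hW.law 0 t t.2.1
  simp only [Set.Icc.coe_zero, sub_zero] at h
  refine h.congr ?_
  filter_upwards [hW.zero] with ω hω
  simp [hω]

lemma isGaussianProcess (hW : IsBrownianMotion W P) : IsGaussianProcess W P :=
  HasIndepIncrements.isGaussianProcess (fun t => (hW.hasLaw_eval t).hasGaussianLaw)
    hW.zero hW.indep

/-- Split `W_t` into `W_s` and an independent centered increment. -/
lemma integral_inner_mul_inner_of_le (hW : IsBrownianMotion W P) {s t : unitInterval} (hst : s ≤ t)
    (x y : EuclideanSpace ℝ (Fin m)) :
    ∫ ω, ⟪x, W s ω⟫_ℝ * ⟪y, W t ω⟫_ℝ ∂P = s * ⟪x, y⟫_ℝ := by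
  have hps : ((s : ℝ) • (1 : Matrix (Fin m) (Fin m) ℝ)).PosSemidef :=
    Matrix.PosSemidef.one.smul s.2.1
  have hG (t : unitInterval) : HasGaussianLaw (W t) P := (hW.hasLaw_eval t).hasGaussianLaw
  have hI (u : unitInterval) (z : EuclideanSpace ℝ (Fin m)) :
      MemLp (fun ω => ⟪z, W u ω⟫_ℝ) 2 P := ((hG u).map_fun (innerSL ℝ z)).memLp_two
  have h0 (u : unitInterval) (z : EuclideanSpace ℝ (Fin m)) : ∫ ω, ⟪z, W u ω⟫_ℝ ∂P = 0 := by
    have h1 := ContinuousLinearMap.integral_comp_comm (innerSL ℝ z) (hG u).integrable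
    simp only [innerSL_apply_apply] at h1
    have h2 := (hW.hasLaw_eval u).integral_eq
    rw [h1, h2, integral_id_multivariateGaussian, inner_zero_right]
  have hsplit (ω : Ω) : ⟪x, W s ω⟫_ℝ * ⟪y, W t ω⟫_ℝ =
      ⟪x, W s ω⟫_ℝ * ⟪y, W s ω⟫_ℝ + ⟪x, W s ω⟫_ℝ * (⟪y, W t ω⟫_ℝ - ⟪y, W s ω⟫_ℝ) := by ring
  simp_rw [hsplit]
  have hadd := integral_add ((hI s x).integrable_mul (hI s y))
    ((hI s x).integrable_mul ((hI t y).sub (hI s y)))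
  simp only [Pi.mul_apply, Pi.sub_apply] at hadd
  rw [hadd]
  have hind : ∫ ω, ⟪x, W s ω⟫_ℝ * (⟪y, W t ω⟫_ℝ - ⟪y, W s ω⟫_ℝ) ∂P = 0 := by
    have h1 := hW.indep.indepFun_eval_sub (bot_le (a := s)) hst hW.zero
    have h2 := h1.comp (φ := fun z => ⟪x, z⟫_ℝ) (ψ := fun z => ⟪y, z⟫_ℝ) (by fun_prop)
      (by fun_prop)
    have h3 := h2.integral_fun_mul_eq_mul_integral (hI s x).aestronglyMeasurable
      (by
        refine ((hI t y).sub (hI s y)).aestronglyMeasurable.congr (.of_forall fun ω => ?_)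
        simp [inner_sub_right])
    simp only [Function.comp_apply, Pi.sub_apply, inner_sub_right] at h3
    rw [h3, h0, zero_mul]
  have hvar : ∫ ω, ⟪x, W s ω⟫_ℝ * ⟪y, W s ω⟫_ℝ ∂P = s * ⟪x, y⟫_ℝ := by
    have h1 := covarianceBilin_multivariateGaussian (μ := 0) hps x y
    rw [← (hW.hasLaw_eval s).map_eq, covarianceBilin_apply_eq_cov
      (by rw [(hW.hasLaw_eval s).map_eq]; exact IsGaussian.memLp_two_id),
      covariance_map (by fun_prop) (by fun_prop) (hG s).aemeasurable] at h1
    simp only [Function.comp_def] at h1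
    rw [covariance_eq_sub (hI s x) (hI s y)] at h1
    simp only [Pi.mul_apply] at h1
    rw [h0, zero_mul, sub_zero] at h1
    rw [h1, Matrix.smul_mulVec, Matrix.one_mulVec, dotProduct_smul, smul_eq_mul,
      EuclideanSpace.inner_eq_star_dotProduct, dotProduct_comm]
    simp
  rw [hvar, hind, add_zero]

lemma continuousVersion_ae_eq (hW : IsBrownianMotion W P) :
    ∀ᵐ ω ∂P, ∀ t, continuousVersion W ω t = W t ω :=
  KalmanBridge.continuousVersion_ae_eq hW.cont

lemma hasGaussianLaw_continuousVersion (hW : IsBrownianMotion W P) :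
    HasGaussianLaw (continuousVersion W) P ∧
      ∀ L : PathSpace m →L[ℝ] ℝ, ∫ ω, L (continuousVersion W ω) ∂P = 0 := by
  have hae (t : unitInterval) : W t =ᵐ[P] fun ω => continuousVersion W ω t := by
    filter_upwards [hW.continuousVersion_ae_eq] with ω hω using (hω t).symm
  refine hasGaussianLaw_of_isGaussianProcess (hW.isGaussianProcess.congr hae) fun t => ?_
  rw [← integral_congr_ae (hae t), (hW.hasLaw_eval t).integral_eq,
    integral_id_multivariateGaussian]

lemma integral_inner_mul_inner_continuousVersion (hW : IsBrownianMotion W P) (s t : unitInterval)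
    (x y : EuclideanSpace ℝ (Fin m)) :
    ∫ ω, ⟪x, continuousVersion W ω s⟫_ℝ * ⟪y, continuousVersion W ω t⟫_ℝ ∂P =
      min (s : ℝ) t * ⟪x, y⟫_ℝ := by
  have h : ∫ ω, ⟪x, continuousVersion W ω s⟫_ℝ * ⟪y, continuousVersion W ω t⟫_ℝ ∂P =
      ∫ ω, ⟪x, W s ω⟫_ℝ * ⟪y, W t ω⟫_ℝ ∂P := by
    refine integral_congr_ae ?_
    filter_upwards [hW.continuousVersion_ae_eq] with ω hω
    simp [hω]
  rw [h]
  rcases le_total s t with hst | hst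
  · rw [hW.integral_inner_mul_inner_of_le hst, min_eq_left (by exact_mod_cast hst)]
  · simp_rw [mul_comm ⟪x, _⟫_ℝ]
    rw [hW.integral_inner_mul_inner_of_le hst, min_eq_right (by exact_mod_cast hst),
      real_inner_comm]

end IsBrownianMotion

end Brownian

/-! ### Covariances of linear functionals of Brownian motion -/

section Covariance

open scoped InnerProductSpace

variable {d m : ℕ} {Ω : Type*} [MeasurableSpace Ω] {P : Measure Ω} [IsProbabilityMeasure P]
  {W : unitInterval → Ω → EuclideanSpace ℝ (Fin m)}

lemma integrable_smul_of_memLp_two {E : Type*} [NormedAddCommGroup E] [NormedSpace ℝ E]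
    {f : Ω → ℝ} {g : Ω → E} (hf : MemLp f 2 P) (hg : MemLp g 2 P) :
    Integrable (fun ω => f ω • g ω) P :=
  memLp_one_iff_integrable.1 (hg.smul hf)

/-- `L` is the functional `w ↦ ⟨h_t, w_t⟩ - ∫_0^t ⟨h'_s, w_s⟩ ds`, that is `∫_0^t ⟨h, dw⟩` when
`h'` is the derivative of `h` and `w_0 = 0`. -/
structure IsStieltjes (L : PathSpace m →L[ℝ] ℝ) (h h' : ℝ → EuclideanSpace ℝ (Fin m))
    (t : unitInterval) : Prop where
  hasDerivAt : ∀ s, HasDerivAt h (h' s) s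
  continuous_deriv : Continuous h'
  apply_eq : ∀ w, L w = ⟪h t, w t⟫_ℝ - ∫ s in (0 : ℝ)..t, ⟪h' s, extend w s⟫_ℝ

lemma IsStieltjes.continuous {L : PathSpace m →L[ℝ] ℝ} {h h' : ℝ → EuclideanSpace ℝ (Fin m)}
    {t : unitInterval} (hL : IsStieltjes L h h' t) : Continuous h :=
  continuous_iff_continuousAt.2 fun s => (hL.hasDerivAt s).continuousAt

/-- Undoes the integration by parts on continuously differentiable paths from `0`. -/
lemma IsStieltjes.apply_primitive {L : PathSpace m →L[ℝ] ℝ} {h h' : ℝ → EuclideanSpace ℝ (Fin m)}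
    {t : unitInterval} (hL : IsStieltjes L h h' t) {k : ℝ → EuclideanSpace ℝ (Fin m)}
    (hk : Continuous k) {w : PathSpace m} (hw : ∀ s, w s = ∫ r in (0 : ℝ)..s, k r) :
    L w = ∫ s in (0 : ℝ)..t, ⟪h s, k s⟫_ℝ := by
  have hc := hL.continuous
  have hc' := hL.continuous_deriv
  set K : ℝ → EuclideanSpace ℝ (Fin m) := fun s => ∫ r in (0 : ℝ)..s, k r with hK
  have hKd (s : ℝ) : HasDerivAt K (k s) s :=
    intervalIntegral.integral_hasDerivAt_right (hk.intervalIntegrable _ _)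
      (hk.stronglyMeasurableAtFilter _ _) hk.continuousAt
  have hKc : Continuous K := continuous_iff_continuousAt.2 fun s => (hKd s).continuousAt
  have hd (s : ℝ) : HasDerivAt (fun s => ⟪h s, K s⟫_ℝ) (⟪h s, k s⟫_ℝ + ⟪h' s, K s⟫_ℝ) s :=
    (hL.hasDerivAt s).inner ℝ (hKd s)
  have h1 := intervalIntegral.integral_eq_sub_of_hasDerivAt (a := 0) (b := t) (fun s _ => hd s)
    (Continuous.intervalIntegrable (by fun_prop) _ _)
  rw [intervalIntegral.integral_add (Continuous.intervalIntegrable (by fun_prop) _ _)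
    (Continuous.intervalIntegrable (by fun_prop) _ _)] at h1
  have h2 : K 0 = 0 := by simp [hK]
  have h3 : ∫ s in (0 : ℝ)..t, ⟪h' s, extend w s⟫_ℝ = ∫ s in (0 : ℝ)..t, ⟪h' s, K s⟫_ℝ := by
    refine intervalIntegral.integral_congr fun s hs => ?_
    rw [Set.uIcc_of_le t.2.1] at hs
    simp only [extend_of_mem w ⟨hs.1, hs.2.trans t.2.2⟩, hw, hK]
  rw [hL.apply_eq, h3, hw t]
  change ⟪h t, K t⟫_ℝ - _ = _
  rw [h2, inner_zero_right] at h1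
  linarith

/-- These paths are the sections of the Brownian covariance. Their derivative jumps at `s`, so
`apply_primitive` does not cover them and the integral is split there. -/
lemma IsStieltjes.apply_min {L : PathSpace m →L[ℝ] ℝ} {h h' : ℝ → EuclideanSpace ℝ (Fin m)}
    (hL : IsStieltjes L h h' 1) {s : unitInterval} {x : EuclideanSpace ℝ (Fin m)}
    {w : PathSpace m} (hw : ∀ r : unitInterval, w r = min (s : ℝ) r • x) :
    L w = ⟪∫ r in (0 : ℝ)..s, h r, x⟫_ℝ := by
  have hc := hL.continuous
  have hc' := hL.continuous_deriv
  have hleft : ∫ r in (0 : ℝ)..s, ⟪h' r, extend w r⟫_ℝ =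
      s * ⟪h s, x⟫_ℝ - ∫ r in (0 : ℝ)..s, ⟪h r, x⟫_ℝ := by
    have hd (r : ℝ) : HasDerivAt (fun r => r * ⟪h r, x⟫_ℝ) (⟪h r, x⟫_ℝ + r * ⟪h' r, x⟫_ℝ) r := by
      have h1 := (hL.hasDerivAt r).inner ℝ (hasDerivAt_const r x)
      exact ((hasDerivAt_id r).mul h1).congr_deriv (by simp)
    have h2 := intervalIntegral.integral_eq_sub_of_hasDerivAt (a := 0) (b := s) (fun r _ => hd r)
      (Continuous.intervalIntegrable (by fun_prop) _ _)
    rw [intervalIntegral.integral_add (Continuous.intervalIntegrable (by fun_prop) _ _)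
      (Continuous.intervalIntegrable (by fun_prop) _ _)] at h2
    have h3 : ∫ r in (0 : ℝ)..s, ⟪h' r, extend w r⟫_ℝ = ∫ r in (0 : ℝ)..s, r * ⟪h' r, x⟫_ℝ := by
      refine intervalIntegral.integral_congr fun r hr => ?_
      rw [Set.uIcc_of_le s.2.1] at hr
      simp only [extend_of_mem w ⟨hr.1, hr.2.trans s.2.2⟩, hw]
      rw [min_eq_right hr.2, inner_smul_right]
    rw [h3]
    linarith
  have hright : ∫ r in (s : ℝ)..1, ⟪h' r, extend w r⟫_ℝ = s * (⟪h 1, x⟫_ℝ - ⟪h s, x⟫_ℝ) := by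
    have hd (r : ℝ) : HasDerivAt (fun r => s * ⟪h r, x⟫_ℝ) (s * ⟪h' r, x⟫_ℝ) r := by
      have h1 := (hL.hasDerivAt r).inner ℝ (hasDerivAt_const r x)
      simpa using h1.const_mul (s : ℝ)
    have h2 := intervalIntegral.integral_eq_sub_of_hasDerivAt (a := s) (b := 1) (fun r _ => hd r)
      (Continuous.intervalIntegrable (by fun_prop) _ _)
    have h3 : ∫ r in (s : ℝ)..1, ⟪h' r, extend w r⟫_ℝ = ∫ r in (s : ℝ)..1, s * ⟪h' r, x⟫_ℝ := by
      refine intervalIntegral.integral_congr fun r hr => ?_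
      rw [Set.uIcc_of_le s.2.2] at hr
      simp only [extend_of_mem w ⟨s.2.1.trans hr.1, hr.2⟩, hw]
      rw [min_eq_left hr.1, inner_smul_right]
    rw [h3, h2]
    ring
  have hsplit := intervalIntegral.integral_add_adjacent_intervals (μ := volume)
    (f := fun r => ⟪h' r, extend w r⟫_ℝ) (a := 0) (b := s) (c := 1)
    (Continuous.intervalIntegrable (by fun_prop) _ _)
    (Continuous.intervalIntegrable (by fun_prop) _ _)
  have hcomm := ((innerSL ℝ).flip x).intervalIntegral_comp_comm
    (hc.intervalIntegrable (μ := volume) 0 s)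
  simp only [ContinuousLinearMap.flip_apply, innerSL_apply_apply] at hcomm
  rw [hL.apply_eq, hw 1, ← hcomm]
  simp only [Set.Icc.coe_one]
  rw [← hsplit, hleft, hright, min_eq_left s.2.2, inner_smul_right]
  ring

lemma IsBrownianMotion.memLp_continuousVersion (hW : IsBrownianMotion W P) :
    MemLp (continuousVersion W) 2 P :=
  hW.hasGaussianLaw_continuousVersion.1.memLp_two

lemma IsBrownianMotion.memLp_clm (hW : IsBrownianMotion W P) {E : Type*} [NormedAddCommGroup E]
    [NormedSpace ℝ E] (L : PathSpace m →L[ℝ] E) :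
    MemLp (fun ω => L (continuousVersion W ω)) 2 P :=
  L.comp_memLp' hW.memLp_continuousVersion

/-- The Itô isometry by duality: `E[L(W) L'(W)] = L(E[L'(W) W])`, and the path `E[L'(W) W]` is the
primitive of `k`. One functional may end at any `t`, the other at `1`, which covers covariances with
the endpoint. -/
lemma IsBrownianMotion.integral_mul_of_isStieltjes (hW : IsBrownianMotion W P)
    {L L' : PathSpace m →L[ℝ] ℝ} {h h' k k' : ℝ → EuclideanSpace ℝ (Fin m)} {t : unitInterval}
    (hL : IsStieltjes L h h' t) (hL' : IsStieltjes L' k k' 1) :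
    ∫ ω, L (continuousVersion W ω) * L' (continuousVersion W ω) ∂P =
      ∫ s in (0 : ℝ)..t, ⟪h s, k s⟫_ℝ := by
  set Z := continuousVersion W with hZ
  have hint (M : PathSpace m →L[ℝ] ℝ) : Integrable (fun ω => M (Z ω) • Z ω) P :=
    integrable_smul_of_memLp_two (hW.memLp_clm M) hW.memLp_continuousVersion
  have hcomm (M M' : PathSpace m →L[ℝ] ℝ) :
      ∫ ω, M (Z ω) * M' (Z ω) ∂P = M (∫ ω, M' (Z ω) • Z ω ∂P) := by
    rw [← M.integral_comp_comm (hint M')]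
    simp [mul_comm]
  rw [hcomm]
  -- The value at `s` is tested against `x`. A second exchange moves `L'` onto the path `E[⟪x, W_s⟫
  -- W] = min(s, ·) x`.
  refine hL.apply_primitive hL'.continuous fun s => ext_inner_left ℝ fun x => ?_
  set M : PathSpace m →L[ℝ] ℝ := innerSL ℝ x ∘L ContinuousMap.evalCLM ℝ s with hM
  have h1 : ⟪x, (∫ ω, L' (Z ω) • Z ω ∂P) s⟫_ℝ = M (∫ ω, L' (Z ω) • Z ω ∂P) := rfl
  rw [h1, ← hcomm]
  simp_rw [mul_comm (M _)]
  rw [hcomm, hL'.apply_min (s := s) (x := x), real_inner_comm]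
  intro r
  refine ext_inner_left ℝ fun y => ?_
  have h2 : ⟪y, (∫ ω, M (Z ω) • Z ω ∂P) r⟫_ℝ =
      (innerSL ℝ y ∘L ContinuousMap.evalCLM ℝ r) (∫ ω, M (Z ω) • Z ω ∂P) := rfl
  rw [h2, ← hcomm]
  have h3 := hW.integral_inner_mul_inner_continuousVersion r s y x
  simp only [hM, ContinuousLinearMap.comp_apply, ContinuousMap.evalCLM_apply, innerSL_apply_apply]
  rw [h3, inner_smul_right, min_comm]

variable {a : EuclideanSpace ℝ (Fin d) →L[ℝ] EuclideanSpace ℝ (Fin d)}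
  {b : EuclideanSpace ℝ (Fin m) →L[ℝ] EuclideanSpace ℝ (Fin d)}

lemma hasDerivAt_flow_sub_comp
    (a : EuclideanSpace ℝ (Fin d) →L[ℝ] EuclideanSpace ℝ (Fin d))
    (b : EuclideanSpace ℝ (Fin m) →L[ℝ] EuclideanSpace ℝ (Fin d)) (t s : ℝ) :
    HasDerivAt (fun s => flow a (t - s) ∘L b) (-(flow a (t - s) ∘L a ∘L b)) s := by
  have h1 : HasDerivAt (fun s => flow a (t - s)) (-(flow a (t - s) * a)) s := by
    have := (hasDerivAt_flow a (t - s)).scomp s ((hasDerivAt_id s).const_sub t)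
    rwa [neg_smul, one_smul] at this
  have h3 := ((ContinuousLinearMap.compL ℝ (EuclideanSpace ℝ (Fin m))
    (EuclideanSpace ℝ (Fin d)) (EuclideanSpace ℝ (Fin d))).flip b).hasFDerivAt.comp_hasDerivAt
      s h1
  refine h3.congr_deriv ?_
  ext; simp

/-- Partial integration of the variation of constants formula: `⟪u, x_t⟫ = ∫_0^t ⟪(e^{(t-s)a} b)^*
u, dw_s⟫` for paths starting at `0`. -/
lemma isStieltjes_inner_linearResponse
    (a : EuclideanSpace ℝ (Fin d) →L[ℝ] EuclideanSpace ℝ (Fin d))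
    (b : EuclideanSpace ℝ (Fin m) →L[ℝ] EuclideanSpace ℝ (Fin d)) (t : unitInterval)
    (u : EuclideanSpace ℝ (Fin d)) :
    IsStieltjes (innerSL ℝ u ∘L ContinuousMap.evalCLM ℝ t ∘L linearResponse a b)
      (fun s => (flow a (t - s) ∘L b).adjoint u)
      (fun s => -(flow a (t - s) ∘L a ∘L b).adjoint u) t where
  hasDerivAt s := by
    have h2 := hasDerivAt_flow_sub_comp a b t s
    have h4 := (((ContinuousLinearMap.apply ℝ (EuclideanSpace ℝ (Fin m)) u) ∘L
      (ContinuousLinearMap.adjoint (𝕜 := ℝ) (E := EuclideanSpace ℝ (Fin m))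
        (F := EuclideanSpace ℝ (Fin d))).toContinuousLinearEquiv.toContinuousLinearMap
      )).hasFDerivAt.comp_hasDerivAt s h2
    exact h4.congr_deriv (by simp)
  continuous_deriv := by fun_prop
  apply_eq w := by
    have hc : Continuous fun s => flow a (t - s) (a (b (extend w s))) := by fun_prop
    have h1 := (innerSL ℝ u).intervalIntegral_comp_comm (hc.intervalIntegrable (μ := volume) 0 t)
    simp only [innerSL_apply_apply] at h1
    simp only [ContinuousLinearMap.comp_apply, innerSL_apply_apply, ContinuousMap.evalCLM_apply,
      linearResponse_apply, linearResponseFun, inner_add_right, ← h1, inner_neg_left,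
      intervalIntegral.integral_neg, sub_neg_eq_add, ContinuousLinearMap.adjoint_inner_left,
      extend_coe, sub_self, flow_zero, one_apply_eq_self]

/-- Isometry plus `e^{(t-s)a} = e^{ta} e^{-sa}`, which pulls the flows out of the integral and
leaves the Gramian. -/
lemma IsBrownianMotion.integral_inner_linearResponse (hW : IsBrownianMotion W P)
    (t : unitInterval) (u v : EuclideanSpace ℝ (Fin d)) :
    ∫ ω, ⟪u, linearResponse a b (continuousVersion W ω) t⟫_ℝ *
      ⟪v, linearResponse a b (continuousVersion W ω) 1⟫_ℝ ∂P =
      ⟪u, (flow a t * gramian a b t * (flow a 1).adjoint) v⟫_ℝ := by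
  have h := hW.integral_mul_of_isStieltjes (isStieltjes_inner_linearResponse a b t u)
    (isStieltjes_inner_linearResponse a b 1 v)
  simp only [ContinuousLinearMap.comp_apply, innerSL_apply_apply,
    ContinuousMap.evalCLM_apply] at h
  rw [h]
  change _ = ⟪u, flow a t (gramian a b t ((flow a 1).adjoint v))⟫_ℝ
  rw [← ContinuousLinearMap.adjoint_inner_left, inner_gramian]
  refine intervalIntegral.integral_congr fun s _ => ?_
  have h1 (t : ℝ) (u : EuclideanSpace ℝ (Fin d)) : (flow a (t - s) ∘L b).adjoint u =
      (flow a (-s) ∘L b).adjoint ((flow a t).adjoint u) := by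
    rw [sub_eq_add_neg, flow_add, ContinuousLinearMap.mul_def, ContinuousLinearMap.comp_assoc,
      ContinuousLinearMap.adjoint_comp]
    rfl
  simp only [h1, Set.Icc.coe_one]

/-- The bridge is uncorrelated with the endpoint. -/
lemma IsBrownianMotion.integral_inner_bridgeMap (hW : IsBrownianMotion W P)
    (hu : IsUnit (gramian a b 1)) (t : unitInterval) (u v : EuclideanSpace ℝ (Fin d)) :
    ∫ ω, ⟪u, bridgeMap a b (continuousVersion W ω) t⟫_ℝ *
      ⟪v, linearResponse a b (continuousVersion W ω) 1⟫_ℝ ∂P = 0 := by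
  have hI (t : unitInterval) (u : EuclideanSpace ℝ (Fin d)) :
      MemLp (fun ω => ⟪u, linearResponse a b (continuousVersion W ω) t⟫_ℝ) 2 P :=
    hW.memLp_clm (innerSL ℝ u ∘L ContinuousMap.evalCLM ℝ t ∘L linearResponse a b)
  have hsplit (ω : Ω) : ⟪u, bridgeMap a b (continuousVersion W ω) t⟫_ℝ *
      ⟪v, linearResponse a b (continuousVersion W ω) 1⟫_ℝ =
      ⟪u, linearResponse a b (continuousVersion W ω) t⟫_ℝ *
        ⟪v, linearResponse a b (continuousVersion W ω) 1⟫_ℝ -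
      ⟪(regression a b t).adjoint u, linearResponse a b (continuousVersion W ω) 1⟫_ℝ *
        ⟪v, linearResponse a b (continuousVersion W ω) 1⟫_ℝ := by
    rw [bridgeMap_apply, inner_sub_right, ContinuousLinearMap.adjoint_inner_left, sub_mul]
  have h := integral_sub ((hI t u).integrable_mul (hI 1 v))
    ((hI 1 ((regression a b t).adjoint u)).integrable_mul (hI 1 v))
  simp only [Pi.mul_apply] at h
  simp_rw [hsplit]
  rw [h, hW.integral_inner_linearResponse, hW.integral_inner_linearResponse,
    ContinuousLinearMap.adjoint_inner_left, ← regression_mul hu t, sub_eq_zero]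
  simp [mul_assoc]

/-- Both are linear images of one Gaussian path, so vanishing covariances suffice. For an arbitrary
functional `L₁` on path space, pull `L₁` out of the expectation; the remaining path-valued
expectation is zero because each of its values is. -/
lemma IsBrownianMotion.indepFun_bridgeMap (hW : IsBrownianMotion W P)
    (hu : IsUnit (gramian a b 1)) :
    IndepFun (fun ω => bridgeMap a b (continuousVersion W ω))
      (fun ω => linearResponse a b (continuousVersion W ω) 1) P := by
  have hG := hW.hasGaussianLaw_continuousVersion
  have hpair : HasGaussianLaw (fun ω => (bridgeMap a b (continuousVersion W ω),
      linearResponse a b (continuousVersion W ω) 1)) P :=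
    hG.1.map_fun ((bridgeMap a b).prod (ContinuousMap.evalCLM ℝ 1 ∘L linearResponse a b))
  refine hpair.indepFun_of_covariance_strongDual fun L₁ L₂ => ?_
  have hM₁ := hW.memLp_clm (L₁ ∘L bridgeMap a b)
  set K : PathSpace m →L[ℝ] ℝ := L₂ ∘L ContinuousMap.evalCLM ℝ 1 ∘L linearResponse a b with hK
  have hM₂ := hW.memLp_clm K
  have h0 := hG.2 K
  have h1 := covariance_eq_sub hM₁ hM₂
  rw [h0, mul_zero, sub_zero] at h1
  refine h1.trans ?_
  have hint : Integrable (fun ω => K (continuousVersion W ω) •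
      bridgeMap a b (continuousVersion W ω)) P :=
    integrable_smul_of_memLp_two hM₂ (hW.memLp_clm (bridgeMap a b))
  have h2 : ∫ ω, K (continuousVersion W ω) • bridgeMap a b (continuousVersion W ω) ∂P = 0 := by
    ext1 t
    refine ext_inner_left ℝ fun u => ?_
    have h3 := (innerSL ℝ u ∘L ContinuousMap.evalCLM ℝ t).integral_comp_comm hint
    simp only [ContinuousLinearMap.comp_apply, innerSL_apply_apply, map_smul, smul_eq_mul,
      ContinuousMap.evalCLM_apply] at h3
    rw [← h3, ContinuousMap.zero_apply, inner_zero_right]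
    obtain ⟨v, rfl⟩ := (InnerProductSpace.toDual ℝ (EuclideanSpace ℝ (Fin d))).surjective L₂
    rw [← hW.integral_inner_bridgeMap hu t u v]
    exact integral_congr_ae (.of_forall fun ω => mul_comm _ _)
  have h4 := L₁.integral_comp_comm hint
  rw [h2, map_zero] at h4
  refine Eq.trans ?_ h4
  exact integral_congr_ae (.of_forall fun ω => by simp [mul_comm])

end Covariance

/-! ### Full support of nondegenerate Gaussian laws -/

section Support

open scoped InnerProductSpace MatrixOrder

variable {d : ℕ}

/-- A continuous surjective image of a product of measures with full support. -/
instance isOpenPosMeasure_stdGaussian :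
    (stdGaussian (EuclideanSpace ℝ (Fin d))).IsOpenPosMeasure := by
  have : (gaussianReal 0 1).IsOpenPosMeasure :=
    (gaussianReal_absolutelyContinuous' 0 one_ne_zero).isOpenPosMeasure
  rw [stdGaussian_eq_map_pi_orthonormalBasis (EuclideanSpace.basisFun (Fin d) ℝ)]
  refine Continuous.isOpenPosMeasure_map (by fun_prop) fun x => ⟨fun i => x i, ?_⟩
  exact (EuclideanSpace.basisFun (Fin d) ℝ).sum_repr x

lemma isOpenPosMeasure_multivariateGaussian (μ : EuclideanSpace ℝ (Fin d))
    {S : Matrix (Fin d) (Fin d) ℝ} (hS : S.PosSemidef) (hu : IsUnit S) :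
    (multivariateGaussian μ S).IsOpenPosMeasure := by
  have h1 : CFC.sqrt S * CFC.sqrt S = S := CFC.sqrt_mul_sqrt_self _ hS.nonneg
  have h2 : IsUnit (CFC.sqrt S) := by
    refine isUnit_of_mul_isUnit_left (y := CFC.sqrt S) ?_
    rwa [h1]
  have h3 := (ContinuousLinearMap.isUnit_iff_bijective.1
    (h2.map (Matrix.toEuclideanCLM (𝕜 := ℝ) (n := Fin d)))).2
  refine Continuous.isOpenPosMeasure_map (by fun_prop) fun x => ?_
  obtain ⟨y, hy⟩ := h3 (x - μ)
  exact ⟨y, by simp [hy]⟩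

/-- A Gaussian law whose covariance form is given by an invertible operator has full support. -/
lemma isOpenPosMeasure_of_isGaussian {γ : Measure (EuclideanSpace ℝ (Fin d))} [IsGaussian γ]
    {C : EuclideanSpace ℝ (Fin d) →L[ℝ] EuclideanSpace ℝ (Fin d)}
    (hC : ∀ u v, covarianceBilin γ u v = ⟪u, C v⟫_ℝ) (hu : IsUnit C) : γ.IsOpenPosMeasure := by
  set S := (Matrix.toEuclideanCLM (𝕜 := ℝ) (n := Fin d)).symm C with hS
  have hSC : Matrix.toEuclideanCLM (𝕜 := ℝ) (n := Fin d) S = C := by simp [hS]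
  have hdot (u v : EuclideanSpace ℝ (Fin d)) : covarianceBilin γ u v = u ⬝ᵥ S.mulVec v := by
    rw [hC, ← hSC, Matrix.inner_toEuclideanCLM]
  have hpsd : S.PosSemidef := by
    refine Matrix.PosSemidef.of_dotProduct_mulVec_nonneg ?_ fun x => ?_
    · ext i j
      have h1 := covarianceBilin_comm (μ := γ) (EuclideanSpace.single i 1)
        (EuclideanSpace.single j 1)
      rw [hdot, hdot] at h1
      simpa using h1.symm
    · have h1 := covarianceBilin_self_nonneg (μ := γ) (WithLp.toLp 2 x)
      rw [hdot] at h1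
      simpa using h1
  -- A Gaussian law is determined by its mean and covariance form.
  have hγ : γ = multivariateGaussian (∫ x, x ∂γ) S := by
    refine IsGaussian.ext (by simp) ?_
    ext u v
    rw [hdot, covarianceBilin_multivariateGaussian hpsd]
  rw [hγ]
  refine isOpenPosMeasure_multivariateGaussian _ hpsd ?_
  exact hu.map (Matrix.toEuclideanCLM (𝕜 := ℝ) (n := Fin d)).symm

end Support

/-! ### Kernels of shifted laws -/

section Kernel

variable {d : ℕ} {Ω : Type*} [MeasurableSpace Ω] {P : Measure Ω} [IsProbabilityMeasure P]

/-- The kernel `y ↦ law of N + φ y`, where `N` has law `ν`. -/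
def shiftKernel (ν : Measure (PathSpace d)) (φ : C(EuclideanSpace ℝ (Fin d), PathSpace d)) :
    Kernel (EuclideanSpace ℝ (Fin d)) (PathSpace d) :=
  (Kernel.id ×ₖ Kernel.const _ ν).map fun p => p.2 + φ p.1

lemma shiftKernel_apply (ν : Measure (PathSpace d)) [IsProbabilityMeasure ν]
    (φ : C(EuclideanSpace ℝ (Fin d), PathSpace d)) (y : EuclideanSpace ℝ (Fin d)) :
    shiftKernel ν φ y = ν.map fun z => z + φ y := by
  have hm : Measurable fun p : EuclideanSpace ℝ (Fin d) × PathSpace d => p.2 + φ p.1 := by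
    fun_prop
  rw [shiftKernel, Kernel.map_apply _ hm, Kernel.prod_apply, Kernel.id_apply, Kernel.const_apply,
    Measure.dirac_prod, Measure.map_map hm (by fun_prop)]
  rfl

instance isMarkovKernel_shiftKernel (ν : Measure (PathSpace d)) [IsProbabilityMeasure ν]
    (φ : C(EuclideanSpace ℝ (Fin d), PathSpace d)) : IsMarkovKernel (shiftKernel ν φ) := by
  refine ⟨fun y => ?_⟩
  rw [shiftKernel_apply]
  exact Measure.isProbabilityMeasure_map (by fun_prop)

lemma continuous_kernelLaw_shiftKernel (ν : Measure (PathSpace d)) [IsProbabilityMeasure ν]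
    (φ : C(EuclideanSpace ℝ (Fin d), PathSpace d)) : Continuous (kernelLaw (shiftKernel ν φ)) := by
  refine continuous_iff_continuousAt.2 fun y => ?_
  refine ProbabilityMeasure.tendsto_iff_forall_integral_tendsto.2 fun f => ?_
  have h (y : EuclideanSpace ℝ (Fin d)) :
      ∫ z, f z ∂(kernelLaw (shiftKernel ν φ) y : Measure (PathSpace d)) =
        ∫ z, f (z + φ y) ∂ν := by
    change ∫ z, f z ∂(shiftKernel ν φ y) = _
    rw [shiftKernel_apply, integral_map (by fun_prop)
      f.continuous.measurable.aestronglyMeasurable]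
  simp_rw [h]
  refine (continuous_of_dominated (bound := fun _ => ‖f‖) (fun y => ?_) (fun y => ?_)
    (integrable_const _) ?_).tendsto y
  · exact (f.continuous.comp (continuous_add_const _)).measurable.aestronglyMeasurable
  · exact .of_forall fun z => f.norm_coe_le_norm _
  · exact .of_forall fun z => by fun_prop

/-- Freezing: by independence the joint law is the image of a product measure under the shear `(y,
z) ↦ (y, z + φ y)`. -/
lemma hasCondDistrib_shiftKernel (φ : C(EuclideanSpace ℝ (Fin d), PathSpace d)) {N Y : Ω → PathSpace d} {Y₁ : Ω → EuclideanSpace ℝ (Fin d)}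
    (hN : AEMeasurable N P) (hY₁ : AEMeasurable Y₁ P) (hind : IndepFun N Y₁ P)
    (hY : ∀ᵐ ω ∂P, Y ω = N ω + φ (Y₁ ω)) :
    HasCondDistrib Y Y₁ (shiftKernel (P.map N) φ) P := by
  have : IsProbabilityMeasure (P.map N) := Measure.isProbabilityMeasure_map hN
  have : IsProbabilityMeasure (P.map Y₁) := Measure.isProbabilityMeasure_map hY₁
  set g : EuclideanSpace ℝ (Fin d) × PathSpace d → EuclideanSpace ℝ (Fin d) × PathSpace d :=
    fun p => (p.1, p.2 + φ p.1) with hg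
  have hgm : Measurable g := by fun_prop
  have hae : (fun ω => (Y₁ ω, Y ω)) =ᵐ[P] fun ω => g (Y₁ ω, N ω) := by
    filter_upwards [hY] with ω hω
    simp [hg, hω]
  refine ⟨(hgm.comp_aemeasurable (hY₁.prodMk hN)).congr hae.symm, ?_⟩
  have h1 : P.map (fun ω => (Y₁ ω, N ω)) = (P.map Y₁).prod (P.map N) :=
    (indepFun_iff_map_prod_eq_prod_map_map hY₁ hN).1 hind.symm
  have h2 : P.map (fun ω => g (Y₁ ω, N ω)) = (P.map fun ω => (Y₁ ω, N ω)).map g :=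
    (AEMeasurable.map_map_of_aemeasurable hgm.aemeasurable (hY₁.prodMk hN)).symm
  rw [Measure.map_congr hae, h2, h1]
  ext s hs
  rw [Measure.map_apply hgm hs, Measure.prod_apply (hgm hs), Measure.compProd_apply hs]
  refine lintegral_congr fun y => ?_
  rw [shiftKernel_apply, Measure.map_apply (by fun_prop) (measurable_prodMk_left hs)]
  rfl

/-- Two regular conditional distributions agree almost everywhere for the endpoint law; continuity
and full support extend this to every endpoint. -/
lemma IsBridge.unique {X : Ω → PathSpace d}
    {κ κ' : Kernel (EuclideanSpace ℝ (Fin d)) (PathSpace d)} [IsMarkovKernel κ] [IsMarkovKernel κ']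
    [(P.map fun ω => X ω 1).IsOpenPosMeasure] (h : IsBridge X P κ) (h' : IsBridge X P κ') :
    κ = κ' := by
  have hm : AEMeasurable (fun ω => X ω 1) P := h.condDistrib.aemeasurable_fst
  have : IsProbabilityMeasure (P.map fun ω => X ω 1) := Measure.isProbabilityMeasure_map hm
  have h1 : κ =ᵐ[P.map fun ω => X ω 1] κ' :=
    Kernel.ae_eq_of_compProd_eq (h.condDistrib.map_eq.symm.trans h'.condDistrib.map_eq)
  have h2 : kernelLaw κ = kernelLaw κ' := by
    refine (Continuous.ae_eq_iff_eq (P.map fun ω => X ω 1) h.continuous h'.continuous).1 ?_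
    filter_upwards [h1] with y hy
    exact Subtype.ext hy
  ext1 y
  exact congrArg Subtype.val (congrFun h2 y)

end Kernel

/-! ### Bridges of linear diffusions -/

section Bridge

open scoped InnerProductSpace

variable {d m : ℕ} {Ω : Type*} [MeasurableSpace Ω] {P : Measure Ω} [IsProbabilityMeasure P]
  {W : unitInterval → Ω → EuclideanSpace ℝ (Fin m)}
  {a : EuclideanSpace ℝ (Fin d) →L[ℝ] EuclideanSpace ℝ (Fin d)}
  {b : EuclideanSpace ℝ (Fin m) →L[ℝ] EuclideanSpace ℝ (Fin d)}

lemma IsBrownianMotion.aemeasurable_clm (hW : IsBrownianMotion W P)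
    (L : PathSpace m →L[ℝ] PathSpace d) : AEMeasurable (fun ω => L (continuousVersion W ω)) P :=
  L.continuous.measurable.comp_aemeasurable hW.hasGaussianLaw_continuousVersion.1.aemeasurable

lemma IsBrownianMotion.aemeasurable_clm_eval (hW : IsBrownianMotion W P)
    (L : PathSpace m →L[ℝ] PathSpace d) (t : unitInterval) :
    AEMeasurable (fun ω => L (continuousVersion W ω) t) P :=
  (continuous_eval_const t).measurable.comp_aemeasurable (hW.aemeasurable_clm L)

lemma IsBrownianMotion.isOpenPosMeasure_linearResponse (hW : IsBrownianMotion W P)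
    (hu : IsUnit (gramian a b 1)) :
    (P.map fun ω => linearResponse a b (continuousVersion W ω) 1).IsOpenPosMeasure := by
  have hG := hW.hasGaussianLaw_continuousVersion
  have hY : HasGaussianLaw (fun ω => linearResponse a b (continuousVersion W ω) 1) P :=
    hG.1.map_fun (ContinuousMap.evalCLM ℝ 1 ∘L linearResponse a b)
  have := hY.isGaussian_map
  refine isOpenPosMeasure_of_isGaussian (C := flow a 1 * gramian a b 1 * (flow a 1).adjoint)
    (fun u v => ?_) ?_
  · have hI (u : EuclideanSpace ℝ (Fin d)) := hW.memLp_clm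
      (innerSL ℝ u ∘L ContinuousMap.evalCLM ℝ 1 ∘L linearResponse a b)
    have h0 := hG.2 (innerSL ℝ u ∘L ContinuousMap.evalCLM ℝ 1 ∘L linearResponse a b)
    have h1 := covariance_eq_sub (hI u) (hI v)
    rw [h0, zero_mul, sub_zero] at h1
    rw [covarianceBilin_apply_eq_cov IsGaussian.memLp_two_id,
      covariance_map (by fun_prop) (by fun_prop) hY.aemeasurable]
    have h2 := hW.integral_inner_linearResponse (a := a) (b := b) 1 u v
    simp only [Set.Icc.coe_one] at h2
    rw [← h2]
    exact h1
  · exact ((isUnit_flow a 1).mul hu).mul (isUnit_flow a 1).star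

/-- The solution of `dx = a x dt` started at `x`. -/
def flowPath (a : EuclideanSpace ℝ (Fin d) →L[ℝ] EuclideanSpace ℝ (Fin d))
    (x : EuclideanSpace ℝ (Fin d)) : PathSpace d :=
  ⟨fun t => flow a t x, by fun_prop⟩

/-- The conditional mean of the solution of `dx = a x dt + b dW` started at `x` given its value `y`
at time `1`. -/
def bridgeMean (a : EuclideanSpace ℝ (Fin d) →L[ℝ] EuclideanSpace ℝ (Fin d))
    (b : EuclideanSpace ℝ (Fin m) →L[ℝ] EuclideanSpace ℝ (Fin d)) (x : EuclideanSpace ℝ (Fin d)) :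
    C(EuclideanSpace ℝ (Fin d), PathSpace d) where
  toFun y := flowPath a x + applyPath (regressionPath a b) (y - flow a 1 x)
  continuous_toFun := by
    have h : Continuous fun y => (regressionPath a b, y - flow a 1 x) :=
      continuous_const.prodMk (continuous_id.sub continuous_const)
    exact continuous_const.add (continuous_applyPath.comp h)

lemma bridgeMean_apply (x y : EuclideanSpace ℝ (Fin d)) (t : unitInterval) :
    bridgeMean a b x y t = flow a t x + regression a b t (y - flow a 1 x) := rfl

/-- `X` is the solution of `dx = a x dt + b dW` started at `x`. -/
structure IsLinearDiffusion (a : EuclideanSpace ℝ (Fin d) →L[ℝ] EuclideanSpace ℝ (Fin d))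
    (b : EuclideanSpace ℝ (Fin m) →L[ℝ] EuclideanSpace ℝ (Fin d))
    (W : unitInterval → Ω → EuclideanSpace ℝ (Fin m)) (P : Measure Ω)
    (x : EuclideanSpace ℝ (Fin d)) (X : Ω → PathSpace d) : Prop where
  apply_eq : ∀ᵐ ω ∂P, ∀ t : unitInterval,
    X ω t = flow a t x + linearResponse a b (continuousVersion W ω) t

variable {x : EuclideanSpace ℝ (Fin d)} {X : Ω → PathSpace d}

lemma IsLinearDiffusion.isOpenPosMeasure (hX : IsLinearDiffusion a b W P x X)
    (hW : IsBrownianMotion W P) (hu : IsUnit (gramian a b 1)) :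
    (P.map fun ω => X ω 1).IsOpenPosMeasure := by
  have h1 := hW.isOpenPosMeasure_linearResponse hu
  have h2 : (fun ω => X ω 1) =ᵐ[P]
      fun ω => flow a 1 x + linearResponse a b (continuousVersion W ω) 1 := by
    filter_upwards [hX.apply_eq] with ω hω
    exact hω 1
  have h3 : P.map (fun ω => flow a 1 x + linearResponse a b (continuousVersion W ω) 1) =
      (P.map fun ω => linearResponse a b (continuousVersion W ω) 1).map (flow a 1 x + ·) :=
    (AEMeasurable.map_map_of_aemeasurable (by fun_prop)
      (hW.aemeasurable_clm_eval (linearResponse a b) 1)).symm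
  rw [Measure.map_congr h2, h3]
  exact Continuous.isOpenPosMeasure_map (by fun_prop) fun y => ⟨y - flow a 1 x, by simp⟩

/-- Almost surely `X` is the `0`-to-`0` bridge of the same Brownian path plus the conditional mean
evaluated at `X_1`, and the first summand is independent of `X_1`. -/
lemma IsLinearDiffusion.isBridge (hX : IsLinearDiffusion a b W P x X)
    (hW : IsBrownianMotion W P) (hu : IsUnit (gramian a b 1)) (ν : Measure (PathSpace d))
    [IsProbabilityMeasure ν] (hν : ν = P.map fun ω => bridgeMap a b (continuousVersion W ω)) :
    IsBridge X P (shiftKernel ν (bridgeMean a b x)) where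
  condDistrib := by
    have hm : AEMeasurable (fun ω => linearResponse a b (continuousVersion W ω) 1) P :=
      hW.aemeasurable_clm_eval (linearResponse a b) 1
    have h2 : (fun ω => flow a 1 x + linearResponse a b (continuousVersion W ω) 1) =ᵐ[P]
        fun ω => X ω 1 := by
      filter_upwards [hX.apply_eq] with ω hω
      exact (hω 1).symm
    rw [hν]
    refine hasCondDistrib_shiftKernel _ (hW.aemeasurable_clm (bridgeMap a b))
      ((hm.const_add (flow a 1 x)).congr h2) ?_ ?_
    · refine IndepFun.congr (f := fun ω => bridgeMap a b (continuousVersion W ω)) ?_ .rfl h2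
      exact (hW.indepFun_bridgeMap hu).comp (φ := id) (ψ := fun y => flow a 1 x + y)
        measurable_id (by fun_prop)
    · filter_upwards [hX.apply_eq] with ω hω
      ext1 t
      rw [ContinuousMap.add_apply, bridgeMap_apply, bridgeMean_apply, hω t, hω 1, Set.Icc.coe_one,
        add_sub_cancel_left]
      abel
  continuous := continuous_kernelLaw_shiftKernel _ _

end Bridge

/-! ### Wiener integrals of continuously differentiable integrands -/

section WienerIntegral

open scoped InnerProductSpace

variable {E H : Type*} [NormedAddCommGroup E] [NormedSpace ℝ E] [CompleteSpace E]
  [NormedAddCommGroup H] [NormedSpace ℝ H] [CompleteSpace H]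

/-- Summation by parts for Riemann-Stieltjes sums. -/
lemma sum_sub_eq_sum_integral {f f' : ℝ → (H →L[ℝ] E)} (hf : ∀ s, HasDerivAt f (f' s) s)
    (hf' : Continuous f') {w : ℝ → H} (hw : Continuous w) (p : ℕ → ℝ) (N : ℕ) :
    ∑ i ∈ Finset.range N, f (p i) (w (p (i + 1)) - w (p i)) -
      (f (p N) (w (p N)) - f (p 0) (w (p 0)) - ∫ s in (p 0)..(p N), f' s (w s)) =
      ∑ i ∈ Finset.range N, ∫ s in (p i)..(p (i + 1)), f' s (w s - w (p (i + 1))) := by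
  have h1 (i : ℕ) : ∫ s in (p i)..(p (i + 1)), f' s (w s - w (p (i + 1))) =
      (∫ s in (p i)..(p (i + 1)), f' s (w s)) -
        (f (p (i + 1)) (w (p (i + 1))) - f (p i) (w (p (i + 1)))) := by
    simp_rw [map_sub]
    rw [intervalIntegral.integral_sub (Continuous.intervalIntegrable (by fun_prop) _ _)
      (Continuous.intervalIntegrable (by fun_prop) _ _)]
    congr 1
    exact intervalIntegral.integral_eq_sub_of_hasDerivAt
      (f := fun s => f s (w (p (i + 1)))) (fun s _ => by
        simpa using (hf s).clm_apply (hasDerivAt_const s (w (p (i + 1)))))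
      (Continuous.intervalIntegrable (by fun_prop) _ _)
  simp_rw [h1]
  rw [Finset.sum_sub_distrib, intervalIntegral.sum_integral_adjacent_intervals
    fun i _ => Continuous.intervalIntegrable (by fun_prop) _ _,
    ← Finset.sum_range_sub (fun i => f (p i) (w (p i))) N]
  have h2 : ∑ i ∈ Finset.range N, f (p i) (w (p (i + 1)) - w (p i)) =
      ∑ i ∈ Finset.range N, (f (p (i + 1)) (w (p (i + 1))) - f (p i) (w (p i))) -
      ∑ i ∈ Finset.range N, (f (p (i + 1)) (w (p (i + 1))) - f (p i) (w (p (i + 1)))) := by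
    rw [← Finset.sum_sub_distrib]
    exact Finset.sum_congr rfl fun i _ => by rw [map_sub]; abel
  rw [h2]
  abel

/-- Bounds the summation-by-parts error by the size of `f'` times the oscillation of `w` on the
mesh; the interval lengths add up to at most `1`. -/
lemma norm_sum_integral_le {f' : ℝ → (H →L[ℝ] E)} {w : ℝ → H} {p : ℕ → ℝ} (hp : Monotone p)
    {N : ℕ} (h0 : 0 ≤ p 0) (h1 : p N ≤ 1) {K δ : ℝ} (hδ : 0 ≤ δ)
    (hK : ∀ s ∈ Set.Icc (0 : ℝ) 1, ‖f' s‖ ≤ K)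
    (hw : ∀ i < N, ∀ s ∈ Set.Icc (p i) (p (i + 1)), ‖w s - w (p (i + 1))‖ ≤ δ) :
    ‖∑ i ∈ Finset.range N, ∫ s in (p i)..(p (i + 1)), f' s (w s - w (p (i + 1)))‖ ≤ K * δ := by
  have hK0 : 0 ≤ K := (norm_nonneg _).trans (hK 0 ⟨le_rfl, zero_le_one⟩)
  have hb : ∀ i ∈ Finset.range N,
      ‖∫ s in (p i)..(p (i + 1)), f' s (w s - w (p (i + 1)))‖ ≤ K * δ * (p (i + 1) - p i) := by
    intro i hi
    have hi' := Finset.mem_range.1 hi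
    have hle : p i ≤ p (i + 1) := hp i.le_succ
    have := intervalIntegral.norm_integral_le_of_norm_le_const (a := p i) (b := p (i + 1))
      (f := fun s => f' s (w s - w (p (i + 1)))) (C := K * δ) fun s hs => ?_
    · rwa [abs_of_nonneg (sub_nonneg.2 hle)] at this
    · rw [Set.uIoc_of_le hle] at hs
      refine (ContinuousLinearMap.le_opNorm _ _).trans ?_
      refine mul_le_mul (hK s ⟨h0.trans ((hp (Nat.zero_le i)).trans hs.1.le),
        hs.2.trans ((hp (Nat.succ_le_of_lt hi')).trans h1)⟩)
        (hw i hi' s ⟨hs.1.le, hs.2⟩) (norm_nonneg _) hK0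
  refine (norm_sum_le_of_le _ hb).trans ?_
  rw [← Finset.mul_sum, Finset.sum_range_sub]
  exact mul_le_of_le_one_right (mul_nonneg hK0 hδ) (by linarith)

variable {Ω : Type*} [MeasurableSpace Ω] {P : Measure Ω}

lemma tendsto_eLpNorm_two_of_dominated {g : ℕ → Ω → E} {G : Ω → ℝ}
    (hg : ∀ n, AEStronglyMeasurable (g n) P) (hG : MemLp G 2 P)
    (hb : ∀ n, ∀ᵐ ω ∂P, ‖g n ω‖ ≤ G ω)
    (hlim : ∀ᵐ ω ∂P, Tendsto (fun n => g n ω) atTop (𝓝 0)) :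
    Tendsto (fun n => eLpNorm (g n) 2 P) atTop (𝓝 0) := by
  have h2 (f : Ω → E) : eLpNorm f 2 P = (∫⁻ ω, ‖f ω‖ₑ ^ (2 : ℝ) ∂P) ^ (1 / 2 : ℝ) := by
    simpa using eLpNorm_eq_lintegral_rpow_enorm_toReal (μ := P) (f := f)
      (two_ne_zero (α := ENNReal)) ENNReal.ofNat_ne_top
  have h3 : Tendsto (fun n => ∫⁻ ω, ‖g n ω‖ₑ ^ (2 : ℝ) ∂P) atTop (𝓝 (∫⁻ _, 0 ∂P)) := by
    refine tendsto_lintegral_of_dominated_convergence' (fun ω => ‖G ω‖ₑ ^ (2 : ℝ))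
      (fun n => (hg n).enorm.pow_const _) (fun n => ?_) ?_ ?_
    · filter_upwards [hb n] with ω hω
      gcongr
      rw [enorm_le_iff_norm_le]
      exact hω.trans (le_abs_self _)
    · have h4 := hG.2
      have h5 := lintegral_rpow_enorm_lt_top_of_eLpNorm_lt_top (two_ne_zero (α := ENNReal))
        ENNReal.ofNat_ne_top h4
      simpa using h5.ne
    · filter_upwards [hlim] with ω hω
      have h4 := (ENNReal.continuous_rpow_const (y := 2)).tendsto 0 |>.comp
        (continuous_enorm.tendsto (0 : E) |>.comp hω |>.trans (by simp))
      simpa [Function.comp_def] using h4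
  simp_rw [h2]
  have h4 := (ENNReal.continuous_rpow_const (y := (1 / 2 : ℝ))).tendsto 0
  rw [lintegral_zero] at h3
  simpa [Function.comp_def] using h4.comp h3

variable {d m : ℕ}

/-- The partition points `min (i / (n + 1)) t`. -/
def gridPoint (t : unitInterval) (n i : ℕ) : unitInterval :=
  min (Set.projIcc 0 1 zero_le_one ((i : ℝ) / (n + 1))) t

lemma monotone_gridPoint (t : unitInterval) (n : ℕ) : Monotone (gridPoint t n) := by
  intro i j hij
  refine min_le_min (Set.monotone_projIcc _ ?_) le_rfl
  gcongr

lemma gridPoint_zero (t : unitInterval) (n : ℕ) : gridPoint t n 0 = 0 := by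
  have : Set.projIcc (0 : ℝ) 1 zero_le_one (((0 : ℕ) : ℝ) / (n + 1)) = 0 := by
    simp only [Nat.cast_zero, zero_div, Set.projIcc_left]
    rfl
  rw [gridPoint, this]
  exact min_eq_left t.2.1

lemma gridPoint_last (t : unitInterval) (n : ℕ) : gridPoint t n (n + 1) = t := by
  have : Set.projIcc (0 : ℝ) 1 zero_le_one (((n + 1 : ℕ) : ℝ) / (n + 1)) = 1 := by
    have : (((n + 1 : ℕ) : ℝ) / (n + 1)) = 1 := by
      push_cast
      exact div_self (by positivity)
    rw [this, Set.projIcc_right]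
    rfl
  rw [gridPoint, this]
  exact min_eq_right t.2.2

lemma gridPoint_succ_sub_le (t : unitInterval) (n i : ℕ) :
    (gridPoint t n (i + 1) : ℝ) - gridPoint t n i ≤ 1 / (n + 1) := by
  have hn : (0 : ℝ) < n + 1 := by positivity
  have h0 : 0 ≤ (i : ℝ) / (n + 1) := by positivity
  have h0' : 0 ≤ 1 / ((n : ℝ) + 1) := by positivity
  have h1 : ((i + 1 : ℕ) : ℝ) / (n + 1) = i / (n + 1) + 1 / (n + 1) := by
    push_cast
    ring
  have hc (x : ℝ) (y : unitInterval) : ((min (Set.projIcc 0 1 zero_le_one x) y : unitInterval) : ℝ)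
      = min (max 0 (min 1 x)) y := by
    have : Monotone (Subtype.val : unitInterval → ℝ) := fun _ _ h => h
    rw [this.map_min, Set.coe_projIcc]
  simp only [gridPoint, hc, h1]
  have := t.2.1
  grind

/-- The step function with value `f (p_i)` on the interval `(p_i, p_{i+1}]` of a grid. -/
def gridStep (f : ℝ → (EuclideanSpace ℝ (Fin m) →L[ℝ] EuclideanSpace ℝ (Fin d)))
    (t : unitInterval) (n : ℕ) : StepFunction d m t where
  N := n + 1
  p := gridPoint t n
  mono := monotone_gridPoint t n
  p_zero := gridPoint_zero t n
  p_last := gridPoint_last t n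
  c i := f (gridPoint t n i)

lemma exists_mem_Ioc_of_mem {p : ℕ → ℝ} {N : ℕ} {s : ℝ} (hs : s ∈ Set.Ioc (p 0) (p N)) :
    ∃ i < N, s ∈ Set.Ioc (p i) (p (i + 1)) := by
  induction N with
  | zero => exact absurd hs (by simp)
  | succ N ih =>
    by_cases h : s ≤ p N
    · obtain ⟨i, hi, his⟩ := ih ⟨hs.1, h⟩
      exact ⟨i, hi.trans N.lt_succ_self, his⟩
    · exact ⟨N, N.lt_succ_self, lt_of_not_ge h, hs.2⟩

lemma exists_gridStep_toFun_eq
    (f : ℝ → (EuclideanSpace ℝ (Fin m) →L[ℝ] EuclideanSpace ℝ (Fin d)))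
    (t : unitInterval) (n : ℕ) {s : ℝ} (hs : s ∈ Set.Ioc (0 : ℝ) t) :
    ∃ r ∈ Set.Icc (0 : ℝ) s, s - r ≤ 1 / (n + 1) ∧ (gridStep f t n).toFun s = f r := by
  set p : ℕ → ℝ := fun i => gridPoint t n i with hp
  have hpm : Monotone p := fun i j hij => monotone_gridPoint t n hij
  obtain ⟨i, hi, his⟩ := exists_mem_Ioc_of_mem (p := p) (N := n + 1) (s := s)
    (by simpa [hp, gridPoint_zero, gridPoint_last] using hs)
  refine ⟨p i, ⟨(gridPoint t n i).2.1, his.1.le⟩, ?_, ?_⟩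
  · have := gridPoint_succ_sub_le t n i
    have := his.2
    simp only [hp] at *
    linarith
  · rw [StepFunction.toFun, Finset.sum_eq_single i]
    · exact Set.indicator_of_mem his _
    · intro j _ hji
      refine Set.indicator_of_notMem (fun hjs => ?_) _
      exact Set.disjoint_left.1 (hpm.pairwise_disjoint_on_Ioc_succ hji) hjs his
    · intro h
      exact absurd (Finset.mem_range.2 hi) h

variable [IsProbabilityMeasure P] {W : unitInterval → Ω → EuclideanSpace ℝ (Fin m)}

/-- The Wiener integral of a continuously differentiable integrand, by partial integration. -/
lemma IsBrownianMotion.isWienerIntegral (hW : IsBrownianMotion W P) {t : unitInterval}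
    {f f' : ℝ → (EuclideanSpace ℝ (Fin m) →L[ℝ] EuclideanSpace ℝ (Fin d))}
    (hf : ∀ s, HasDerivAt f (f' s) s) (hf' : Continuous f')
    {L : PathSpace m →L[ℝ] EuclideanSpace ℝ (Fin d)}
    (hL : ∀ w, L w = f t (w t) - ∫ s in (0 : ℝ)..t, f' s (extend w s)) :
    IsWienerIntegral W P t f (fun ω => L (continuousVersion W ω)) := by
  have hfc : Continuous f := continuous_iff_continuousAt.2 fun s => (hf s).continuousAt
  obtain ⟨K, hK⟩ := (isCompact_Icc (a := (0 : ℝ)) (b := 1)).exists_bound_of_continuousOn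
    hf'.continuousOn
  have hK0 : 0 ≤ K := (norm_nonneg _).trans (hK 0 ⟨le_rfl, zero_le_one⟩)
  have hLm := (hW.memLp_clm L).aestronglyMeasurable
  refine ⟨hLm, gridStep f t, ?_, ?_⟩
  · have hbound (n : ℕ) : ∫⁻ s in Set.Ioc (0 : ℝ) t, ‖f s - (gridStep f t n).toFun s‖ₑ ^ 2 ≤
        ENNReal.ofReal (K * (1 / (n + 1))) ^ 2 := by
      calc _ ≤ ∫⁻ _ in Set.Ioc (0 : ℝ) t, ENNReal.ofReal (K * (1 / (n + 1))) ^ 2 := by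
            refine setLIntegral_mono measurable_const fun s hs => ?_
            obtain ⟨r, hr, hsr, heq⟩ := exists_gridStep_toFun_eq f t n hs
            gcongr
            rw [heq, ← ofReal_norm]
            refine ENNReal.ofReal_le_ofReal ?_
            have hmv := Convex.norm_image_sub_le_of_norm_hasDerivWithin_le (f := f) (f' := f')
              (C := K) (s := Set.Icc (0 : ℝ) 1) (x := r) (y := s)
              (fun x _ => (hf x).hasDerivWithinAt) hK (convex_Icc 0 1)
              ⟨hr.1, hr.2.trans (hs.2.trans t.2.2)⟩ ⟨hs.1.le, hs.2.trans t.2.2⟩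
            refine hmv.trans (mul_le_mul_of_nonneg_left ?_ hK0)
            rwa [Real.norm_of_nonneg (sub_nonneg.2 hr.2)]
        _ ≤ _ := by
            rw [setLIntegral_const, Real.volume_Ioc, sub_zero]
            exact mul_le_of_le_one_right (by positivity) (ENNReal.ofReal_le_one.2 t.2.2)
    have hlim : Tendsto (fun n : ℕ => ENNReal.ofReal (K * (1 / ((n : ℝ) + 1))) ^ 2) atTop
        (𝓝 0) := by
      have h1 : Tendsto (fun n : ℕ => K * (1 / ((n : ℝ) + 1))) atTop (𝓝 (K * 0)) :=
        tendsto_one_div_add_atTop_nhds_zero_nat.const_mul K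
      have h2 := ((ENNReal.continuous_pow 2).comp ENNReal.continuous_ofReal).tendsto (K * 0)
      simpa [Function.comp_def] using h2.comp h1
    exact tendsto_of_tendsto_of_tendsto_of_le_of_le tendsto_const_nhds hlim
      (fun _ => zero_le) hbound
  -- One pathwise bound, used twice: `δ = 2‖W‖` gives a square integrable majorant, and small `δ`,
  -- from uniform continuity of the path, gives pointwise convergence.
  · have hdiff : ∀ᵐ ω ∂P, ∀ (n : ℕ) (δ : ℝ), 0 ≤ δ →
        (∀ r s : ℝ, |r - s| ≤ 1 / (n + 1) →
          ‖extend (continuousVersion W ω) r - extend (continuousVersion W ω) s‖ ≤ δ) →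
        ‖L (continuousVersion W ω) - (gridStep f t n).integral W ω‖ ≤ K * δ := by
      filter_upwards [hW.continuousVersion_ae_eq, hW.zero] with ω hω h0 n δ hδ hosc
      set w := continuousVersion W ω with hw
      set p : ℕ → ℝ := fun i => gridPoint t n i with hp
      have hpm : Monotone p := fun i j hij => monotone_gridPoint t n hij
      have hp0 : p 0 = 0 := by simp [hp, gridPoint_zero]
      have hpN : p (n + 1) = t := by simp [hp, gridPoint_last]
      have hw0 : w 0 = 0 := by rw [hω, h0]
      have h1 := sum_sub_eq_sum_integral hf hf' (w := extend w) (by fun_prop) p (n + 1)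
      have h2 := norm_sum_integral_le (f' := f') (w := extend w) hpm (N := n + 1) hp0.ge
        (hpN.le.trans t.2.2) hδ hK fun i hi s hs => hosc _ _ (by
          rw [abs_sub_comm, abs_of_nonneg (sub_nonneg.2 hs.2)]
          have := gridPoint_succ_sub_le t n i
          have := hs.1
          simp only [hp] at *
          linarith)
      have h3 : extend w 0 = 0 := by
        rw [← hw0, ← extend_coe w 0]
        simp
      have h4 : (gridStep f t n).integral W ω =
          ∑ i ∈ Finset.range (n + 1), f (p i) (extend w (p (i + 1)) - extend w (p i)) := by
        refine Finset.sum_congr rfl fun i _ => ?_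
        simp only [gridStep, hp, extend_coe, hω]
      rw [← h1, hp0, hpN, h3, map_zero, sub_zero, extend_coe, ← hL, ← h4, norm_sub_rev] at h2
      exact h2
    refine tendsto_eLpNorm_two_of_dominated (G := fun ω => K * (2 * ‖continuousVersion W ω‖))
      (fun n => ?_) ((hW.memLp_continuousVersion.norm.const_mul 2).const_mul K) (fun n => ?_) ?_
    · refine hLm.sub (AEMeasurable.aestronglyMeasurable ?_)
      have hWm (s : unitInterval) : AEMeasurable (W s) P := (hW.hasLaw_eval s).aemeasurable
      unfold StepFunction.integral
      refine Finset.aemeasurable_fun_sum _ fun i _ => ?_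
      exact (ContinuousLinearMap.measurable _).comp_aemeasurable ((hWm _).sub (hWm _))
    · filter_upwards [hdiff] with ω hω
      refine hω n _ (by positivity) fun r s _ => ?_
      refine (norm_sub_le _ _).trans ?_
      linarith [norm_extend_le (continuousVersion W ω) r, norm_extend_le (continuousVersion W ω) s]
    · filter_upwards [hdiff] with ω hω
      rw [Metric.tendsto_atTop]
      intro ε hε
      -- `K` may be zero, hence the `+ 1`.
      have hε' : 0 < ε / (K + 1) := by positivity
      have huc : UniformContinuous (extend (continuousVersion W ω)) :=
        (CompactSpace.uniformContinuous_of_continuous (continuousVersion W ω).continuous).comp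
          (LipschitzWith.projIcc zero_le_one).uniformContinuous
      obtain ⟨η, hη, hη'⟩ := Metric.uniformContinuous_iff.1 huc _ hε'
      obtain ⟨N, hN⟩ := exists_nat_one_div_lt hη
      refine ⟨N, fun n hn => ?_⟩
      rw [dist_zero_right]
      refine (hω n (ε / (K + 1)) hε'.le fun r s hrs => ?_).trans_lt ?_
      · rw [← dist_eq_norm]
        refine (hη' ?_).le
        rw [Real.dist_eq]
        refine hrs.trans_lt (lt_of_le_of_lt ?_ hN)
        exact one_div_le_one_div_of_le (by positivity) (by gcongr)
      · rw [mul_div_assoc', div_lt_iff₀ (by positivity)]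
        nlinarith

lemma IsBrownianMotion.isWienerIntegral_linearResponse (hW : IsBrownianMotion W P)
    (a : EuclideanSpace ℝ (Fin d) →L[ℝ] EuclideanSpace ℝ (Fin d))
    (b : EuclideanSpace ℝ (Fin m) →L[ℝ] EuclideanSpace ℝ (Fin d)) (t : unitInterval) :
    IsWienerIntegral W P t (fun s => flow a (t - s) ∘L b)
      (fun ω => linearResponse a b (continuousVersion W ω) t) := by
  refine hW.isWienerIntegral (f' := fun s => -(flow a (t - s) ∘L a ∘L b))
    (L := ContinuousMap.evalCLM ℝ t ∘L linearResponse a b) (fun s => ?_) (by fun_prop) fun w => ?_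
  · exact hasDerivAt_flow_sub_comp a b t s
  · simp [linearResponse_apply, linearResponseFun]

end WienerIntegral

/-! ### Matrices as operators -/

section MatCLM

open scoped InnerProductSpace

variable {p q r d m : ℕ}

lemma matCLM_apply (M : Matrix (Fin p) (Fin q) ℝ) (x : EuclideanSpace ℝ (Fin q)) (i : Fin p) :
    matCLM M x i = ∑ j, M i j * x j := rfl

lemma matCLM_single (M : Matrix (Fin p) (Fin q) ℝ) (c : Fin q) (i : Fin p) :
    matCLM M (EuclideanSpace.single c 1) i = M i c := by
  simp [matCLM_apply]

lemma matCLM_eq_toEuclideanCLM (M : Matrix (Fin p) (Fin p) ℝ) :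
    matCLM M = Matrix.toEuclideanCLM (𝕜 := ℝ) (n := Fin p) M := rfl

lemma matCLM_mul (M : Matrix (Fin p) (Fin q) ℝ) (N : Matrix (Fin q) (Fin r) ℝ) :
    matCLM (M * N) = matCLM M ∘L matCLM N := by
  ext x i
  exact congrFun (Matrix.mulVec_mulVec x.ofLp M N).symm i

lemma matCLM_smul (c : ℝ) (M : Matrix (Fin p) (Fin q) ℝ) : matCLM (c • M) = c • matCLM M := by
  ext x i
  simp [matCLM_apply, Finset.mul_sum, mul_assoc]

lemma matCLM_pow (M : Matrix (Fin p) (Fin p) ℝ) (n : ℕ) : matCLM (M ^ n) = matCLM M ^ n := by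
  simp only [matCLM_eq_toEuclideanCLM, map_pow]

lemma inner_matCLM_single (M : Matrix (Fin p) (Fin q) ℝ) (x : EuclideanSpace ℝ (Fin p))
    (y : EuclideanSpace ℝ (Fin q)) : ⟪x, matCLM M y⟫_ℝ = ∑ i, ∑ j, M i j * (x i * y j) := by
  simp [PiLp.inner_apply, matCLM_apply, Finset.mul_sum, mul_comm, mul_left_comm]

lemma matCLM_transpose (M : Matrix (Fin p) (Fin q) ℝ) :
    matCLM M.transpose = (matCLM M).adjoint := by
  rw [ContinuousLinearMap.eq_adjoint_iff]
  intro x y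
  rw [real_inner_comm, inner_matCLM_single, inner_matCLM_single, Finset.sum_comm]
  simp [mul_comm]

lemma matCLM_exp (s : ℝ) (M : Matrix (Fin p) (Fin p) ℝ) :
    matCLM (NormedSpace.exp (s • M)) = flow (matCLM M) s := by
  let _ : NormedRing (Matrix (Fin p) (Fin p) ℝ) := Matrix.linftyOpNormedRing
  let _ : NormedAlgebra ℝ (Matrix (Fin p) (Fin p) ℝ) := Matrix.linftyOpNormedAlgebra
  let _ : NormedAlgebra ℚ (Matrix (Fin p) (Fin p) ℝ) := NormedAlgebra.restrictScalars ℚ ℝ _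
  have hc : Continuous (Matrix.toEuclideanCLM (𝕜 := ℝ) (n := Fin p)) :=
    LinearMap.continuous_of_finiteDimensional
      (Matrix.toEuclideanCLM (𝕜 := ℝ) (n := Fin p)).toAlgEquiv.toLinearMap
  have h := NormedSpace.map_exp (Matrix.toEuclideanCLM (𝕜 := ℝ) (n := Fin p)) hc (s • M)
  rw [flow, ← matCLM_smul]
  exact h

lemma isUnit_matCLM {M : Matrix (Fin p) (Fin p) ℝ} : IsUnit (matCLM M) ↔ IsUnit M :=
  MulEquiv.isUnit_map (Matrix.toEuclideanCLM (𝕜 := ℝ) (n := Fin p))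

lemma matCLM_inv {M : Matrix (Fin p) (Fin p) ℝ} (hM : IsUnit M) :
    matCLM M⁻¹ = Ring.inverse (matCLM M) := by
  have h : matCLM M⁻¹ * matCLM M = 1 := by
    rw [ContinuousLinearMap.mul_def, ← matCLM_mul,
      Matrix.nonsing_inv_mul _ ((Matrix.isUnit_iff_isUnit_det M).1 hM), matCLM_eq_toEuclideanCLM,
      map_one]
  rw [← mul_one (matCLM M⁻¹), ← Ring.mul_inverse_cancel _ (isUnit_matCLM.2 hM), ← mul_assoc, h,
    one_mul]

lemma continuous_matCLM {X : Type*} [TopologicalSpace X] {M : X → Matrix (Fin p) (Fin q) ℝ}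
    (hM : Continuous M) : Continuous fun x => matCLM (M x) := by
  have h : Continuous fun N : Matrix (Fin p) (Fin q) ℝ => matCLM N :=
    LinearMap.continuous_of_finiteDimensional
      (LinearMap.toContinuousLinearMap.toLinearMap ∘ₗ
        (Matrix.toEuclideanLin (𝕜 := ℝ) (m := Fin p) (n := Fin q)).toLinearMap)
  exact h.comp hM

lemma matCLM_gammaIntegrand (A : Matrix (Fin d) (Fin d) ℝ) (B : Matrix (Fin d) (Fin m) ℝ)
    (ε s : ℝ) : matCLM (gammaIntegrand A B ε s) = (flow (ε • matCLM A) (-s) ∘L matCLM B) ∘L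
      (flow (ε • matCLM A) (-s) ∘L matCLM B).adjoint := by
  rw [gammaIntegrand, matCLM_mul, matCLM_mul, matCLM_mul, matCLM_exp, ← Matrix.transpose_smul,
    Matrix.exp_transpose, matCLM_transpose, matCLM_transpose, matCLM_exp, flow_smul,
    ContinuousLinearMap.adjoint_comp, mul_neg]
  simp only [ContinuousLinearMap.comp_assoc]

lemma matCLM_matGamma (A : Matrix (Fin d) (Fin d) ℝ) (B : Matrix (Fin d) (Fin m) ℝ) (ε t : ℝ) :
    matCLM (matGamma A B ε t) = gramian (ε • matCLM A) (matCLM B) t := by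
  have hentry (M : Matrix (Fin d) (Fin d) ℝ) (i j : Fin d) :
      ⟪EuclideanSpace.single i 1, matCLM M (EuclideanSpace.single j 1)⟫_ℝ = M i j := by
    rw [EuclideanSpace.inner_single_left, matCLM_single]
    simp
  refine ContinuousLinearMap.coe_injective
    ((EuclideanSpace.basisFun (Fin d) ℝ).toBasis.ext fun j => ?_)
  simp only [OrthonormalBasis.coe_toBasis, EuclideanSpace.basisFun_apply,
    ContinuousLinearMap.coe_coe]
  ext i
  have hi : gramian (ε • matCLM A) (matCLM B) t (EuclideanSpace.single j 1) i =
      ⟪EuclideanSpace.single i 1, gramian (ε • matCLM A) (matCLM B) t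
        (EuclideanSpace.single j 1)⟫_ℝ := by
    rw [EuclideanSpace.inner_single_left]
    simp
  rw [matCLM_single, hi, inner_gramian]
  refine intervalIntegral.integral_congr fun s _ => ?_
  refine (hentry (gammaIntegrand A B ε s) i j).symm.trans ?_
  rw [matCLM_gammaIntegrand, ContinuousLinearMap.adjoint_inner_left]
  rfl

/-- The scalar operator `c` intertwines the two systems. It lets `φ`, defined through `B`, serve the
equation with noise `√ε B`. -/
lemma regression_smul_right {a : EuclideanSpace ℝ (Fin d) →L[ℝ] EuclideanSpace ℝ (Fin d)}
    {b : EuclideanSpace ℝ (Fin m) →L[ℝ] EuclideanSpace ℝ (Fin d)} (hab : IsControllable a b)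
    {c : ℝ} (hc : c ≠ 0) (t : ℝ) : regression a (c • b) t = regression a b t := by
  have hT : (c • (1 : EuclideanSpace ℝ (Fin d) →L[ℝ] EuclideanSpace ℝ (Fin d))) ∘L b = c • b := by
    ext; simp
  have hab' : IsControllable a (c • b) := by simpa using hab.smul one_ne_zero hc
  have h := regression_intertwine (T := c • 1) (a := a) (a' := a) (by ext; simp)
    (fun x y hxy => by simpa [hc] using hxy) hab.isUnit_gramian
    (by rw [hT]; exact hab'.isUnit_gramian) t
  rw [hT] at h
  ext1 x
  have h1 := DFunLike.congr_fun h x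
  simpa [hc] using h1

/-- The factor `√ε` drops out of the regression, and `e^{-εA} (y - e^{εA} x) = e^{-εA} y - x`. -/
lemma phi_eq_bridgeMean {A : Matrix (Fin d) (Fin d) ℝ} {B : Matrix (Fin d) (Fin m) ℝ}
    (hAB : IsControllable (matCLM A) (matCLM B)) (x y : EuclideanSpace ℝ (Fin d)) {ε : ℝ}
    (hε : 0 < ε) (t : unitInterval) :
    phi A B x y ε t = bridgeMean (ε • matCLM A) (√ε • matCLM B) x y t := by
  have hab : IsControllable (ε • matCLM A) (matCLM B) := by
    simpa using hAB.smul hε.ne' one_ne_zero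
  have hu : IsUnit (matGamma A B ε 1) := by
    rw [← isUnit_matCLM, matCLM_matGamma]
    exact hab.isUnit_gramian
  rw [bridgeMean_apply, regression_smul_right hab (Real.sqrt_pos.2 hε).ne', phi, matCLM_mul,
    matCLM_mul, matCLM_exp, matCLM_exp, matCLM_inv hu, matCLM_matGamma, matCLM_matGamma,
    flow_smul, regression, flow_smul, flow_smul, flow_smul]
  simp only [ContinuousLinearMap.comp_apply, mul_apply_eq_comp, map_sub, mul_neg, mul_one]
  have h : flow (matCLM A) (-ε) (flow (matCLM A) ε x) = x :=
    DFunLike.congr_fun (flow_neg_mul_flow (matCLM A) ε) x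
  rw [h]

end MatCLM

/-! ### The filtration and the rescaled generator -/

section Filtration

open scoped InnerProductSpace

variable {d m : ℕ} {A : Matrix (Fin d) (Fin d) ℝ} {B : Matrix (Fin d) (Fin m) ℝ}

lemma pow_apply_mem_filtE {l k : ℕ} (hl : l < k) (v : EuclideanSpace ℝ (Fin m)) :
    (matCLM A ^ l) (matCLM B v) ∈ filtE A B k :=
  Submodule.subset_span ⟨l, hl, v, by rw [matCLM_mul, matCLM_pow]; rfl⟩

lemma filtE_le_iff {k : ℕ} {S : Submodule ℝ (EuclideanSpace ℝ (Fin d))} :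
    filtE A B k ≤ S ↔ ∀ l < k, ∀ v, (matCLM A ^ l) (matCLM B v) ∈ S := by
  refine ⟨fun h l hl v => h (pow_apply_mem_filtE hl v), fun h => Submodule.span_le.2 ?_⟩
  rintro _ ⟨l, hl, v, rfl⟩
  rw [matCLM_mul, matCLM_pow]
  exact h l hl v

lemma filtE_mono {k l : ℕ} (hkl : k ≤ l) : filtE A B k ≤ filtE A B l :=
  filtE_le_iff.2 fun _ hl v => pow_apply_mem_filtE (hl.trans_le hkl) v

lemma apply_mem_filtE_succ {k : ℕ} {x : EuclideanSpace ℝ (Fin d)} (hx : x ∈ filtE A B k) :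
    matCLM A x ∈ filtE A B (k + 1) := by
  have h : filtE A B k ≤ (filtE A B (k + 1)).comap (matCLM A : _ →ₗ[ℝ] _) :=
    filtE_le_iff.2 fun l hl v => by
      have := pow_apply_mem_filtE (A := A) (B := B) (Nat.succ_lt_succ hl) v
      rwa [pow_succ'] at this
  exact h hx

/-- Full row rank means that the transposed Kalman matrix is injective. -/
lemma KalmanCondition.exists_forall_eq_zero (h : KalmanCondition A B) :
    ∃ N : ℕ, ∀ x : EuclideanSpace ℝ (Fin d),
      (∀ l < N, ∀ v, ⟪x, (matCLM A ^ l) (matCLM B v)⟫_ℝ = 0) → x = 0 := by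
  obtain ⟨N, hN⟩ := h
  refine ⟨N, fun x hx => ?_⟩
  set K := kalmanMatrix A B N with hK
  have hker : LinearMap.ker K.transpose.mulVecLin = ⊥ := by
    have h1 := K.transpose.mulVecLin.finrank_range_add_finrank_ker
    have h2 : Module.finrank ℝ (LinearMap.range K.transpose.mulVecLin) = d :=
      (Matrix.rank_transpose K).trans hN
    rw [h2, Module.finrank_fin_fun] at h1
    exact Submodule.finrank_eq_zero.1 (by omega)
  have hx0 : K.transpose.mulVecLin x.ofLp = 0 := by
    ext ⟨l, c⟩
    have h1 := hx l l.2 (EuclideanSpace.single c 1)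
    have h2 : ((matCLM A ^ (l : ℕ)) (matCLM B (EuclideanSpace.single c 1))) =
        matCLM (A ^ (l : ℕ) * B) (EuclideanSpace.single c 1) := by
      rw [matCLM_mul, matCLM_pow]
      rfl
    rw [h2, PiLp.inner_apply] at h1
    simp only [matCLM_single] at h1
    change ∑ i, (A ^ (l : ℕ) * B) i c * x i = 0
    exact h1
  have h3 : x.ofLp ∈ LinearMap.ker K.transpose.mulVecLin := hx0
  rw [hker, Submodule.mem_bot] at h3
  ext i
  exact congrFun h3 i

lemma KalmanCondition.isControllable (h : KalmanCondition A B) :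
    IsControllable (matCLM A) (matCLM B) := by
  obtain ⟨N, hN⟩ := h.exists_forall_eq_zero
  exact fun x hx => hN x fun l _ v => hx l v

lemma KalmanCondition.exists_filtE_eq_top (h : KalmanCondition A B) :
    ∃ N : ℕ, filtE A B N = ⊤ := by
  obtain ⟨N, hN⟩ := h.exists_forall_eq_zero
  refine ⟨N, Submodule.orthogonal_eq_bot_iff.1 ((Submodule.eq_bot_iff _).2 fun x hx => ?_)⟩
  refine hN x fun l hl v => ?_
  rw [real_inner_comm]
  exact (Submodule.mem_orthogonal _ _).1 hx _ (pow_apply_mem_filtE hl v)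

/-- The dimensions increase with `k` and reach `d`, so the infimum defining `level` is attained and
the default value `sInf ∅ = 0` never occurs. -/
lemma KalmanCondition.lt_dimE_iff (h : KalmanCondition A B) (j : Fin d) (k : ℕ) :
    (j : ℕ) < dimE A B k ↔ level A B j ≤ k := by
  have hne : {k : ℕ | (j : ℕ) < dimE A B k}.Nonempty := by
    obtain ⟨N, hN⟩ := h.exists_filtE_eq_top
    refine ⟨N, ?_⟩
    rw [Set.mem_ofPred_eq, dimE, hN, finrank_top, finrank_euclideanSpace_fin]
    exact j.2
  have hlt : (j : ℕ) < dimE A B (level A B j) := Nat.sInf_mem hne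
  refine ⟨fun hk => Nat.sInf_le hk, fun hk => ?_⟩
  exact hlt.trans_le (Submodule.finrank_mono (filtE_mono hk))

/-- Guarantees that the exponents `level - 1` are genuine, not truncated, differences. -/
lemma KalmanCondition.one_le_level (h : KalmanCondition A B) (j : Fin d) : 1 ≤ level A B j := by
  by_contra hlt
  have h1 := (h.lt_dimE_iff j 0).2 (by omega)
  have h2 : filtE A B 0 = ⊥ := by
    rw [eq_bot_iff, filtE_le_iff]
    intro l hl
    omega
  rw [dimE, h2, finrank_bot] at h1
  omega

variable {e : OrthonormalBasis (Fin d) ℝ (EuclideanSpace ℝ (Fin d))}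

lemma IsAdapted.basis_mem (he : IsAdapted A B e) (hAB : KalmanCondition A B) {j : Fin d} {k : ℕ}
    (hk : level A B j ≤ k) : e j ∈ filtE A B k := by
  rw [← he k]
  exact Submodule.subset_span ⟨j, (hAB.lt_dimE_iff j k).2 hk, rfl⟩

lemma IsAdapted.inner_eq_zero (he : IsAdapted A B e) (hAB : KalmanCondition A B) {j : Fin d}
    {k : ℕ} (hk : k < level A B j) {x : EuclideanSpace ℝ (Fin d)} (hx : x ∈ filtE A B k) :
    ⟪e j, x⟫_ℝ = 0 := by
  have h : filtE A B k ≤ LinearMap.ker (innerSL ℝ (e j) : _ →ₗ[ℝ] ℝ) := by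
    rw [← he k, Submodule.span_le]
    rintro _ ⟨i, hi, rfl⟩
    have hij : j ≠ i := by
      rintro rfl
      exact absurd ((hAB.lt_dimE_iff j k).1 hi) (by omega)
    exact e.orthonormal.2 hij
  exact h hx

/-- The block Hessenberg shape of `A`: one application raises the filtration by at most one step. -/
lemma IsAdapted.inner_apply_eq_zero (he : IsAdapted A B e) (hAB : KalmanCondition A B)
    {i j : Fin d} (h : level A B j + 1 < level A B i) : ⟪e i, matCLM A (e j)⟫_ℝ = 0 :=
  he.inner_eq_zero hAB h (apply_mem_filtE_succ (he.basis_mem hAB le_rfl))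

lemma IsAdapted.inner_pow_eq_zero (he : IsAdapted A B e) (hAB : KalmanCondition A B)
    {i : Fin d} {l : ℕ} (h : l + 1 < level A B i) (v : EuclideanSpace ℝ (Fin m)) :
    ⟪e i, (matCLM A ^ l) (matCLM B v)⟫_ℝ = 0 :=
  he.inner_eq_zero hAB h (pow_apply_mem_filtE l.lt_succ_self v)

lemma inner_apply_eq_sum (e : OrthonormalBasis (Fin d) ℝ (EuclideanSpace ℝ (Fin d)))
    (T : EuclideanSpace ℝ (Fin d) →L[ℝ] EuclideanSpace ℝ (Fin d))
    (y x : EuclideanSpace ℝ (Fin d)) : ⟪y, T x⟫_ℝ = ∑ j, ⟪y, T (e j)⟫_ℝ * e.repr x j := by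
  conv_lhs => rw [← e.sum_repr x]
  simp [map_sum, inner_sum, inner_smul_right, mul_comm]

/-- The generator `ε D_ε^{-1} A D_ε` in the basis `e`; its entries are polynomials in `ε`. -/
def scaledGenerator (A : Matrix (Fin d) (Fin d) ℝ) (B : Matrix (Fin d) (Fin m) ℝ)
    (e : OrthonormalBasis (Fin d) ℝ (EuclideanSpace ℝ (Fin d))) (ε : ℝ) :
    EuclideanSpace ℝ (Fin d) →L[ℝ] EuclideanSpace ℝ (Fin d) :=
  matCLM (Matrix.of fun i j =>
    -- The subtraction truncates only where the inner product vanishes, given an adapted basis and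
    -- the Kalman condition. At `ε = 0` the convention `0 ^ 0 = 1` keeps exactly the subdiagonal
    -- blocks.
    ε ^ (level A B j + 1 - level A B i) * ⟪e i, matCLM A (e j)⟫_ℝ)

/-- The noise coefficient `B` in the basis `e`. -/
def noiseCoord (B : Matrix (Fin d) (Fin m) ℝ)
    (e : OrthonormalBasis (Fin d) ℝ (EuclideanSpace ℝ (Fin d))) :
    EuclideanSpace ℝ (Fin m) →L[ℝ] EuclideanSpace ℝ (Fin d) :=
  (e.repr.toContinuousLinearEquiv : _ →L[ℝ] _) ∘L matCLM B

/-- The change of coordinates `D_ε^{-1} e^*`. -/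
def scaledCoord (A : Matrix (Fin d) (Fin d) ℝ) (B : Matrix (Fin d) (Fin m) ℝ)
    (e : OrthonormalBasis (Fin d) ℝ (EuclideanSpace ℝ (Fin d))) (ε : ℝ) :
    EuclideanSpace ℝ (Fin d) →L[ℝ] EuclideanSpace ℝ (Fin d) :=
  matCLM (matD A B ε)⁻¹ ∘L (e.repr.toContinuousLinearEquiv : _ →L[ℝ] _)

lemma noiseCoord_apply (v : EuclideanSpace ℝ (Fin m)) (i : Fin d) :
    noiseCoord B e v i = ⟪e i, matCLM B v⟫_ℝ :=
  e.repr_apply_apply _ _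

lemma scaledGenerator_apply (ε : ℝ) (x : EuclideanSpace ℝ (Fin d)) (i : Fin d) :
    scaledGenerator A B e ε x i =
      ∑ j, ε ^ (level A B j + 1 - level A B i) * ⟪e i, matCLM A (e j)⟫_ℝ * x j := rfl

lemma continuous_scaledGenerator : Continuous (scaledGenerator A B e) := by
  refine continuous_matCLM (continuous_matrix fun i j => ?_)
  exact (continuous_pow _).mul continuous_const

lemma matD_inv {ε : ℝ} (hε : 0 < ε) :
    (matD A B ε)⁻¹ = Matrix.diagonal fun j => (ε ^ (level A B j - 1))⁻¹ := by
  refine Matrix.inv_eq_right_inv ?_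
  rw [matD, Matrix.diagonal_mul_diagonal, ← Matrix.diagonal_one]
  congr 1
  ext j
  exact mul_inv_cancel₀ (by positivity)

lemma scaledCoord_apply {ε : ℝ} (hε : 0 < ε) (x : EuclideanSpace ℝ (Fin d)) (i : Fin d) :
    scaledCoord A B e ε x i = (ε ^ (level A B i - 1))⁻¹ * ⟪e i, x⟫_ℝ := by
  rw [scaledCoord, matD_inv hε, ContinuousLinearMap.comp_apply, matCLM_apply]
  simp [Matrix.diagonal_apply, e.repr_apply_apply]

lemma bijective_scaledCoord {ε : ℝ} (hε : 0 < ε) :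
    Function.Bijective (scaledCoord A B e ε) := by
  have hu : IsUnit (matCLM (matD A B ε)⁻¹) := by
    rw [isUnit_matCLM, matD_inv hε, Matrix.isUnit_diagonal, Pi.isUnit_iff]
    exact fun i => IsUnit.mk0 _ (by positivity)
  exact (ContinuousLinearMap.isUnit_iff_bijective.1 hu).comp e.repr.bijective

/-- `B` takes values in `E_1`, on which `D_ε` is the identity. -/
lemma scaledCoord_comp_noise (he : IsAdapted A B e) (hAB : KalmanCondition A B) {ε : ℝ}
    (hε : 0 < ε) : scaledCoord A B e ε ∘L matCLM B = noiseCoord B e := by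
  ext v i
  rw [ContinuousLinearMap.comp_apply, scaledCoord_apply hε, noiseCoord_apply]
  rcases (hAB.one_le_level i).eq_or_lt with h | h
  · simp [← h]
  · have := he.inner_pow_eq_zero hAB (l := 0) h v
    simp only [pow_zero, one_apply_eq_self] at this
    rw [this, mul_zero]

lemma scaledCoord_intertwine (he : IsAdapted A B e) (hAB : KalmanCondition A B) {ε : ℝ}
    (hε : 0 < ε) : scaledCoord A B e ε ∘L (ε • matCLM A) =
      scaledGenerator A B e ε ∘L scaledCoord A B e ε := by
  ext x i
  rw [ContinuousLinearMap.comp_apply, ContinuousLinearMap.comp_apply, scaledCoord_apply hε,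
    scaledGenerator_apply, smul_apply, inner_smul_right,
    inner_apply_eq_sum e, Finset.mul_sum, Finset.mul_sum]
  refine Finset.sum_congr rfl fun j _ => ?_
  rw [scaledCoord_apply hε, e.repr_apply_apply x j]
  rcases lt_or_ge (level A B j + 1) (level A B i) with h | h
  · rw [he.inner_apply_eq_zero hAB h]
    simp
  · have h1 := hAB.one_le_level i
    have h2 := hAB.one_le_level j
    have h3 : ε ^ (level A B i - 1) * ε ^ (level A B j + 1 - level A B i) =
        ε * ε ^ (level A B j - 1) := by
      rw [← pow_add, ← pow_succ']
      congr 1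
      omega
    have h4 : ε ^ (level A B i - 1) ≠ 0 := by positivity
    have h5 : ε ^ (level A B j - 1) ≠ 0 := by positivity
    have h6 : (ε ^ (level A B i - 1))⁻¹ * ε =
        ε ^ (level A B j + 1 - level A B i) * (ε ^ (level A B j - 1))⁻¹ := by
      field_simp
      rw [h3, mul_comm]
    linear_combination (⟪e i, matCLM A (e j)⟫_ℝ * ⟪e j, x⟫_ℝ) * h6

/-- Powers of the limiting generator only see one block. -/
lemma scaledGenerator_zero_pow_apply (he : IsAdapted A B e) (hAB : KalmanCondition A B) (k : ℕ)
    (v : EuclideanSpace ℝ (Fin m)) (i : Fin d) :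
    (scaledGenerator A B e 0 ^ k) (noiseCoord B e v) i =
      if level A B i = k + 1 then ⟪e i, (matCLM A ^ k) (matCLM B v)⟫_ℝ else 0 := by
  induction k generalizing i with
  | zero =>
    rw [pow_zero, one_apply_eq_self, noiseCoord_apply]
    split_ifs with h
    · simp
    · have h1 := hAB.one_le_level i
      exact he.inner_pow_eq_zero hAB (l := 0) (by omega) v
  | succ k ih =>
    rw [pow_succ', mul_apply_eq_comp, scaledGenerator_apply]
    simp_rw [ih]
    split_ifs with h
    · rw [pow_succ', mul_apply_eq_comp, inner_apply_eq_sum e]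
      refine Finset.sum_congr rfl fun j _ => ?_
      rw [e.repr_apply_apply]
      -- Here `i` lies in block `k + 2`. Lower blocks do not reach it under `A`, block `k + 1` has
      -- coefficient `0 ^ 0 = 1`, and higher blocks do not occur in `A^k B v ∈ E_{k+1}`.
      rcases lt_trichotomy (level A B j) (k + 1) with hj | hj | hj
      · rw [he.inner_apply_eq_zero hAB (i := i) (j := j) (by omega)]
        simp
      · rw [if_pos hj, h, hj, Nat.sub_self, pow_zero, one_mul]
      · rw [if_neg hj.ne', he.inner_pow_eq_zero hAB hj]
        simp
    · refine Finset.sum_eq_zero fun j _ => ?_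
      split_ifs with hj
      · rcases lt_or_ge (level A B j + 1) (level A B i) with hij | hij
        · rw [he.inner_apply_eq_zero hAB hij]
          simp
        · rw [zero_pow (by omega)]
          simp
      · rw [mul_zero]

lemma matLead_eq (i : Fin d) (c : Fin m) : matLead A B e i c =
    ⟪e i, (matCLM A ^ (level A B i - 1)) (matCLM B (EuclideanSpace.single c 1))⟫_ℝ /
      (level A B i - 1).factorial := by
  rw [matLead, Matrix.of_apply, matCLM_mul, matCLM_pow]
  rfl

/-- `e^{rN} b = Û(r)` for the limiting generator `N`. -/
lemma flow_scaledGenerator_zero (he : IsAdapted A B e) (hAB : KalmanCondition A B) (r : ℝ) :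
    flow (scaledGenerator A B e 0) r ∘L noiseCoord B e = matCLM (matUhat A B e r) := by
  refine ContinuousLinearMap.coe_injective
    ((EuclideanSpace.basisFun (Fin m) ℝ).toBasis.ext fun c => ?_)
  simp only [OrthonormalBasis.coe_toBasis, EuclideanSpace.basisFun_apply,
    ContinuousLinearMap.coe_coe]
  ext i
  rw [matCLM_single]
  let p : (EuclideanSpace ℝ (Fin d) →L[ℝ] EuclideanSpace ℝ (Fin d)) →L[ℝ] ℝ :=
    (EuclideanSpace.proj i : EuclideanSpace ℝ (Fin d) →L[ℝ] ℝ) ∘L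
      ContinuousLinearMap.apply ℝ (EuclideanSpace ℝ (Fin d))
        (noiseCoord B e (EuclideanSpace.single c 1))
  have hp (n : ℕ) : p ((r ^ n / n.factorial) • scaledGenerator A B e 0 ^ n) =
      r ^ n / n.factorial * (if level A B i = n + 1 then
        ⟪e i, (matCLM A ^ n) (matCLM B (EuclideanSpace.single c 1))⟫_ℝ else 0) := by
    rw [← scaledGenerator_zero_pow_apply he hAB, map_smul, smul_eq_mul]
    rfl
  have h1 : HasSum (fun n => p ((r ^ n / n.factorial) • scaledGenerator A B e 0 ^ n))
      (p (flow (scaledGenerator A B e 0) r)) :=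
    (hasSum_flow (scaledGenerator A B e 0) r).mapL p
  have hl := hAB.one_le_level i
  have h2 := hasSum_single (f := fun n => p ((r ^ n / n.factorial) • scaledGenerator A B e 0 ^ n))
    (level A B i - 1) (fun n hn => by rw [hp, if_neg (by omega), mul_zero])
  have h3 := h1.unique h2
  rw [hp, if_pos (by omega)] at h3
  refine (show _ = _ from h3).trans ?_
  change _ = r ^ (level A B i - 1) * matLead A B e i c
  rw [matLead_eq]
  ring

/-- Treat `x` block by block. The component `y` in block `k + 1` lies in `E_{k+1}`; it is orthogonal
to `A^l B v` for `l < k` by adaptedness, and for `l = k` by hypothesis, since `a_0^k b v` is the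
block `k + 1` part of `A^k B v`. So `y` is orthogonal to itself. -/
lemma isControllable_scaledGenerator_zero (he : IsAdapted A B e) (hAB : KalmanCondition A B) :
    IsControllable (scaledGenerator A B e 0) (noiseCoord B e) := by
  intro x hx
  have hblock (k : ℕ) : ∑ i, (if level A B i = k + 1 then x i else 0) • e i = 0 := by
    set y := ∑ i, (if level A B i = k + 1 then x i else 0) • e i with hy
    have hmem : y ∈ filtE A B (k + 1) := by
      refine Submodule.sum_mem _ fun i _ => ?_
      split_ifs with h
      · exact Submodule.smul_mem _ _ (he.basis_mem hAB h.le)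
      · simp
    have hle : filtE A B (k + 1) ≤ LinearMap.ker (innerSL ℝ y : _ →ₗ[ℝ] ℝ) := by
      refine filtE_le_iff.2 fun l hl v => ?_
      change ⟪y, _⟫_ℝ = 0
      rw [hy, sum_inner]
      simp_rw [real_inner_smul_left]
      rcases (Nat.lt_succ_iff.1 hl).lt_or_eq with hlk | rfl
      · refine Finset.sum_eq_zero fun i _ => ?_
        split_ifs with h
        · rw [he.inner_pow_eq_zero hAB (by omega), mul_zero]
        · rw [zero_mul]
      · have h1 := hx l v
        rw [PiLp.inner_apply] at h1
        rw [← h1]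
        refine Finset.sum_congr rfl fun i _ => ?_
        rw [scaledGenerator_zero_pow_apply he hAB]
        split_ifs <;> simp [mul_comm]
    have h0 : ⟪y, y⟫_ℝ = 0 := hle hmem
    exact inner_self_eq_zero.1 h0
  ext i
  have h1 := congrArg (fun z => ⟪e i, z⟫_ℝ) (hblock (level A B i - 1))
  have h2 := hAB.one_le_level i
  simp only [inner_sum, inner_smul_right, inner_zero_right, e.inner_eq_ite, mul_ite, mul_one,
    mul_zero, Finset.sum_ite_eq, Finset.mem_univ, if_true] at h1
  rwa [if_pos (by omega)] at h1

end Filtration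

/-! ### The limiting covariance and the expansion of the coefficient -/

/-- The Beta integral, by partial integration that trades a power of `t - s` for one of `s`. -/
lemma integral_sub_pow_mul_pow (p q : ℕ) (t : ℝ) :
    ∫ s in (0 : ℝ)..t, (t - s) ^ p * s ^ q =
      t ^ (p + q + 1) * (p.factorial * q.factorial / (p + q + 1).factorial) := by
  induction p generalizing q with
  | zero =>
    simp only [pow_zero, one_mul, integral_pow, zero_add, Nat.factorial_zero, Nat.cast_one,
      Nat.factorial_succ, Nat.cast_mul, Nat.cast_add]
    field_simp
    simp
  | succ p ih =>
    have hderiv (s : ℝ) : HasDerivAt (fun s => (t - s) ^ (p + 1) * s ^ (q + 1))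
        ((q + 1) * ((t - s) ^ (p + 1) * s ^ q) - (p + 1) * ((t - s) ^ p * s ^ (q + 1))) s := by
      have h := (((hasDerivAt_id s).const_sub t).pow (p + 1)).mul ((hasDerivAt_id s).pow (q + 1))
      refine h.congr_deriv ?_
      simp
      ring
    have hint (u v : ℕ) : IntervalIntegrable (fun s => (t - s) ^ u * s ^ v) volume 0 t :=
      Continuous.intervalIntegrable (by fun_prop) _ _
    have h := intervalIntegral.integral_eq_sub_of_hasDerivAt (fun s _ => hderiv s)
      (((hint (p + 1) q).const_mul _).sub ((hint p (q + 1)).const_mul _))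
    rw [intervalIntegral.integral_sub ((hint (p + 1) q).const_mul _)
      ((hint p (q + 1)).const_mul _), intervalIntegral.integral_const_mul,
      intervalIntegral.integral_const_mul, ih] at h
    simp only [sub_self, ne_eq, Nat.add_eq_zero_iff, one_ne_zero, and_false, not_false_eq_true,
      zero_pow, zero_mul, mul_zero] at h
    have h1 : p + (q + 1) + 1 = p + 1 + q + 1 := by ring
    rw [h1, Nat.factorial_succ q] at h
    rw [Nat.factorial_succ p]
    push_cast at h ⊢
    have h2 : (q + 1 : ℝ) ≠ 0 := by positivity
    refine mul_left_cancel₀ h2 ?_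
    linear_combination h

/-- Source of the sign in `V`: the Gramian uses `e^{-sa}`, hence `Û(-s)`. -/
lemma integral_sub_pow_mul_neg_pow (p q : ℕ) (t : ℝ) :
    ∫ s in (0 : ℝ)..t, (t - s) ^ p * (-s) ^ q =
      (-1) ^ q * (t ^ (p + q + 1) * (p.factorial * q.factorial / (p + q + 1).factorial)) := by
  rw [← integral_sub_pow_mul_pow, ← intervalIntegral.integral_const_mul]
  refine intervalIntegral.integral_congr fun s _ => ?_
  simp only [neg_pow s]
  ring

section LimitCovariance

open scoped InnerProductSpace

variable {d m : ℕ} {A : Matrix (Fin d) (Fin d) ℝ} {B : Matrix (Fin d) (Fin m) ℝ}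
  {e : OrthonormalBasis (Fin d) ℝ (EuclideanSpace ℝ (Fin d))}

lemma matJ_mul_matV_mul_matJ_apply (hAB : KalmanCondition A B) {t : ℝ} (ht : 0 ≤ t)
    (i j : Fin d) : (matJ A B t * matV A B e * matJ A B t) i j =
      t ^ (level A B i + level A B j - 1) * matV A B e i j := by
  have hi : (1 : ℝ) ≤ level A B i := mod_cast hAB.one_le_level i
  have hj : (1 : ℝ) ≤ level A B j := mod_cast hAB.one_le_level j
  have h1 := hAB.one_le_level i
  -- The half-integers add up: `(k - 1/2) + (l - 1/2) = k + l - 1`. Both exponents are positive, so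
  -- `t = 0` is allowed.
  rw [matJ, Matrix.mul_diagonal, Matrix.diagonal_mul, mul_right_comm,
    ← Real.rpow_add_of_nonneg ht (by linarith) (by linarith), ← Real.rpow_natCast]
  congr 2
  rw [Nat.cast_sub (by omega)]
  push_cast
  ring

/-- The right side is `∫_0^t Û(t - s) Û(-s)^* ds`, whose entries are Beta integrals. -/
lemma matCLM_matJ_mul_matV_mul_matJ (he : IsAdapted A B e) (hAB : KalmanCondition A B) {t : ℝ}
    (ht : 0 ≤ t) : matCLM (matJ A B t * matV A B e * matJ A B t) =
      flow (scaledGenerator A B e 0) t * gramian (scaledGenerator A B e 0) (noiseCoord B e) t := by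
  refine ContinuousLinearMap.coe_injective
    ((EuclideanSpace.basisFun (Fin d) ℝ).toBasis.ext fun j => ?_)
  simp only [OrthonormalBasis.coe_toBasis, EuclideanSpace.basisFun_apply,
    ContinuousLinearMap.coe_coe]
  ext i
  have hi (y : EuclideanSpace ℝ (Fin d)) : y i = ⟪EuclideanSpace.single i 1, y⟫_ℝ := by
    rw [EuclideanSpace.inner_single_left]
    simp
  have hadj (s : ℝ) (k : Fin d) (c : Fin m) :
      (flow (scaledGenerator A B e 0) s ∘L noiseCoord B e).adjoint (EuclideanSpace.single k 1) c =
        s ^ (level A B k - 1) * matLead A B e k c := by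
    rw [flow_scaledGenerator_zero he hAB, ← matCLM_transpose, matCLM_single]
    rfl
  have hl := hAB.one_le_level i
  have hl' := hAB.one_le_level j
  rw [matCLM_single, matJ_mul_matV_mul_matJ_apply hAB ht, hi, mul_apply_eq_comp,
    ← ContinuousLinearMap.adjoint_inner_left, inner_gramian]
  have hint (s : ℝ) : ⟪(flow (scaledGenerator A B e 0) (-s) ∘L noiseCoord B e).adjoint
      ((flow (scaledGenerator A B e 0) t).adjoint (EuclideanSpace.single i 1)),
      (flow (scaledGenerator A B e 0) (-s) ∘L noiseCoord B e).adjoint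
        (EuclideanSpace.single j 1)⟫_ℝ =
      (matLead A B e * (matLead A B e).transpose) i j *
        ((t - s) ^ (level A B i - 1) * (-s) ^ (level A B j - 1)) := by
    have h1 : (flow (scaledGenerator A B e 0) (-s) ∘L noiseCoord B e).adjoint
        ((flow (scaledGenerator A B e 0) t).adjoint (EuclideanSpace.single i 1)) =
        (flow (scaledGenerator A B e 0) (t - s) ∘L noiseCoord B e).adjoint
          (EuclideanSpace.single i 1) := by
      rw [← ContinuousLinearMap.comp_apply, ← ContinuousLinearMap.adjoint_comp,
        ← ContinuousLinearMap.comp_assoc, ← ContinuousLinearMap.mul_def, ← flow_add,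
        ← sub_eq_add_neg]
    rw [h1, PiLp.inner_apply, Matrix.mul_apply, Finset.sum_mul]
    refine Finset.sum_congr rfl fun c _ => ?_
    rw [hadj, hadj, Matrix.transpose_apply]
    simp only [RCLike.inner_apply, conj_trivial]
    ring
  simp_rw [hint]
  rw [intervalIntegral.integral_const_mul, integral_sub_pow_mul_neg_pow]
  have h2 : level A B i - 1 + (level A B j - 1) + 1 = level A B i + level A B j - 1 := by omega
  have h3 : (-1 : ℝ) ^ (level A B j + 1) = (-1) ^ (level A B j - 1) := by
    rw [show level A B j + 1 = level A B j - 1 + 2 by omega, pow_add]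
    norm_num
  rw [h2]
  change _ * ((-1 : ℝ) ^ (level A B j + 1) * (matLead A B e * (matLead A B e).transpose) i j *
      (((level A B i - 1).factorial : ℝ) * ((level A B j - 1).factorial : ℝ) /
        ((level A B i + level A B j - 1).factorial : ℝ))) = _
  rw [h3]
  ring

lemma matCLM_matV (he : IsAdapted A B e) (hAB : KalmanCondition A B) : matCLM (matV A B e) =
    flow (scaledGenerator A B e 0) 1 * gramian (scaledGenerator A B e 0) (noiseCoord B e) 1 := by
  rw [← matCLM_matJ_mul_matV_mul_matJ he hAB zero_le_one]
  simp [matJ]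

lemma isUnit_matV (he : IsAdapted A B e) (hAB : KalmanCondition A B) : IsUnit (matV A B e) := by
  rw [← isUnit_matCLM, matCLM_matV he hAB]
  exact (isUnit_flow _ _).mul (isControllable_scaledGenerator_zero he hAB).isUnit_gramian

lemma matCLM_regression (he : IsAdapted A B e) (hAB : KalmanCondition A B) {t : ℝ} (ht : 0 ≤ t) :
    matCLM (matJ A B t * matV A B e * matJ A B t * (matV A B e)⁻¹) =
      regression (scaledGenerator A B e 0) (noiseCoord B e) t := by
  have hu : IsUnit (matCLM (matV A B e)) := isUnit_matCLM.2 (isUnit_matV he hAB)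
  rw [matCLM_mul, matCLM_inv (isUnit_matV he hAB), matCLM_matJ_mul_matV_mul_matJ he hAB ht,
    ← regression_mul (isControllable_scaledGenerator_zero he hAB).isUnit_gramian,
    ← matCLM_matV he hAB, ← ContinuousLinearMap.mul_def, mul_assoc, Ring.mul_inverse_cancel _ hu,
    mul_one]

/-- The intertwining relation read backwards: the prefactor of the leading term is exact, and all
remaining dependence on `ε` is smooth. -/
lemma matU_apply (he : IsAdapted A B e) (hAB : KalmanCondition A B) {ε : ℝ} (hε : 0 < ε) (r : ℝ)
    (j : Fin d) (c : Fin m) : matU A B e ε r j c = ε ^ (level A B j - 1) *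
      flow (scaledGenerator A B e ε) r (noiseCoord B e (EuclideanSpace.single c 1)) j := by
  have h := DFunLike.congr_fun (comp_flow_of_intertwine (scaledCoord_intertwine he hAB hε) r)
    (matCLM B (EuclideanSpace.single c 1))
  rw [← scaledCoord_comp_noise he hAB hε, ContinuousLinearMap.comp_apply,
    ← ContinuousLinearMap.comp_apply (flow _ _), ← h, ContinuousLinearMap.comp_apply,
    scaledCoord_apply hε, mul_inv_cancel_left₀ (by positivity), flow_smul, ← matCLM_exp]
  change ⟪e j, matCLM (NormedSpace.exp ((ε * r) • A) * B) (EuclideanSpace.single c 1)⟫_ℝ = _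
  rw [matCLM_mul]
  rfl

lemma contDiff_scaledGenerator : ContDiff ℝ 1 (scaledGenerator A B e) := by
  refine contDiff_clm_apply_iff.2 fun x => contDiff_euclidean.2 fun i => ?_
  simp only [scaledGenerator_apply]
  fun_prop

lemma contDiff_flow_scaledGenerator :
    ContDiff ℝ 1 fun p : ℝ × ℝ => flow (scaledGenerator A B e p.1) p.2 := by
  have h : ContDiff ℝ 1 fun a : EuclideanSpace ℝ (Fin d) →L[ℝ] EuclideanSpace ℝ (Fin d) =>
      NormedSpace.exp a :=
    contDiff_iff_contDiffAt.2 fun a => (NormedSpace.exp_analytic (𝕂 := ℝ) a).contDiffAt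
  exact h.comp (contDiff_snd.smul (contDiff_scaledGenerator.comp contDiff_fst))

/-- The flow `e^{r a_ε}` is `C^1` in `(ε, r)`, hence Lipschitz on a compact rectangle, so replacing
`a_ε` by `a_0` costs one factor `ε`. -/
lemma exists_abs_matU_sub_le (he : IsAdapted A B e) (hAB : KalmanCondition A B) (R : ℝ) :
    ∃ C : ℝ, ∀ ε ∈ Set.Ioo (0 : ℝ) 1, ∀ r ∈ Set.Icc (-R) R, ∀ j c,
      |matU A B e ε r j c - ε ^ (level A B j - 1) * matUhat A B e r j c| ≤
        C * ε ^ level A B j := by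
  obtain ⟨K, hK⟩ := (contDiff_flow_scaledGenerator (A := A) (B := B)
    (e := e)).contDiffOn.exists_lipschitzOnWith one_ne_zero
    ((convex_Icc (0 : ℝ) 1).prod (convex_Icc (-R) R)) (isCompact_Icc.prod isCompact_Icc)
  refine ⟨K * ‖noiseCoord B e‖, fun ε hε r hr j c => ?_⟩
  have hl := hAB.one_le_level j
  have h1 : ‖flow (scaledGenerator A B e ε) r - flow (scaledGenerator A B e 0) r‖ ≤ K * ε := by
    have h := hK.norm_sub_le (x := (ε, r)) ⟨⟨hε.1.le, hε.2.le⟩, hr⟩ (y := (0, r))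
      ⟨⟨le_rfl, zero_le_one⟩, hr⟩
    refine h.trans_eq ?_
    simp [Prod.norm_def, abs_of_pos hε.1, hε.1.le]
  have h0 : matUhat A B e r j c =
      flow (scaledGenerator A B e 0) r (noiseCoord B e (EuclideanSpace.single c 1)) j := by
    rw [← ContinuousLinearMap.comp_apply, flow_scaledGenerator_zero he hAB, matCLM_single]
  set y := (flow (scaledGenerator A B e ε) r - flow (scaledGenerator A B e 0) r)
    (noiseCoord B e (EuclideanSpace.single c 1)) with hy
  have h2 : ‖y‖ ≤ K * ε * ‖noiseCoord B e‖ := by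
    refine (ContinuousLinearMap.le_opNorm _ _).trans ?_
    refine mul_le_mul h1 ?_ (norm_nonneg _) (by have := hε.1; positivity)
    simpa using (noiseCoord B e).le_opNorm (EuclideanSpace.single c 1)
  have h3 : |y j| ≤ ‖y‖ := PiLp.norm_apply_le y j
  have h4 : matU A B e ε r j c - ε ^ (level A B j - 1) * matUhat A B e r j c =
      ε ^ (level A B j - 1) * y j := by
    rw [matU_apply he hAB hε.1, h0, ← mul_sub]
    rfl
  have h5 : 0 ≤ ε ^ (level A B j - 1) := pow_nonneg hε.1.le _
  rw [h4, abs_mul, abs_of_nonneg h5]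
  calc ε ^ (level A B j - 1) * |y j|
      ≤ ε ^ (level A B j - 1) * (K * ε * ‖noiseCoord B e‖) := by gcongr; exact h3.trans h2
    _ = K * ‖noiseCoord B e‖ * ε ^ (level A B j - 1 + 1) := by ring
    _ = _ := by rw [Nat.sub_add_cancel hl]

end LimitCovariance

/-! ### Convergence of the rescaled fluctuations -/

section Fluctuation

open scoped InnerProductSpace

variable {d m : ℕ} {Ω : Type*} [MeasurableSpace Ω] {P : Measure Ω} [IsProbabilityMeasure P]
  {W : unitInterval → Ω → EuclideanSpace ℝ (Fin m)}
  {A : Matrix (Fin d) (Fin d) ℝ} {B : Matrix (Fin d) (Fin m) ℝ}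
  {e : OrthonormalBasis (Fin d) ℝ (EuclideanSpace ℝ (Fin d))}

lemma IsDiffusion.isLinearDiffusion {ε : ℝ} {x : EuclideanSpace ℝ (Fin d)} {X : Ω → PathSpace d}
    (hX : IsDiffusion A B W P ε x X) (hW : IsBrownianMotion W P) :
    IsLinearDiffusion (ε • matCLM A) (√ε • matCLM B) W P x X where
  apply_eq := by
    filter_upwards [hX.equation, hW.continuousVersion_ae_eq] with ω h1 h2
    refine eq_linearResponse_of_integral_equation fun t => ?_
    rw [h1 t, ← h2 t]
    rfl

lemma IsBrownianMotion.isGaussianProcess_clm (hW : IsBrownianMotion W P)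
    (L : PathSpace m →L[ℝ] PathSpace d) :
    IsGaussianProcess (fun t ω => L (continuousVersion W ω) t) P where
  hasGaussianLaw I := by
    let R : PathSpace d →L[ℝ] (I → EuclideanSpace ℝ (Fin d)) :=
      ContinuousLinearMap.pi fun t => ContinuousMap.evalCLM ℝ (t : unitInterval)
    exact hW.hasGaussianLaw_continuousVersion.1.map_fun (R ∘L L)

/-- The fluctuations of the bridge are the bridge of the rescaled equation. -/
lemma fluctuation_add_bridgeMean (he : IsAdapted A B e) (hAB : KalmanCondition A B) {ε : ℝ}
    (hε : 0 < ε) (x y : EuclideanSpace ℝ (Fin d)) (w : PathSpace m) :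
    fluctuation A B e x y ε (bridgeMap (ε • matCLM A) (√ε • matCLM B) w +
      bridgeMean (ε • matCLM A) (√ε • matCLM B) x y) =
      bridgeMap (scaledGenerator A B e ε) (noiseCoord B e) w := by
  have hs : √ε ≠ 0 := (Real.sqrt_pos.2 hε).ne'
  have hc := hAB.isControllable.smul hε.ne' hs
  set T := (√ε)⁻¹ • scaledCoord A B e ε with hT
  have hinj : Function.Injective T := by
    intro u v huv
    exact (bijective_scaledCoord hε).1 (smul_right_injective _ (inv_ne_zero hs) huv)
  have hsurj : Function.Surjective T := LinearMap.injective_iff_surjective.1 hinj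
  have hTB : T ∘L (√ε • matCLM B) = noiseCoord B e := by
    rw [hT, ContinuousLinearMap.smul_comp, ContinuousLinearMap.comp_smul, smul_smul,
      inv_mul_cancel₀ hs, one_smul, scaledCoord_comp_noise he hAB hε]
  have hTA : T ∘L (ε • matCLM A) = scaledGenerator A B e ε ∘L T := by
    rw [hT, ContinuousLinearMap.smul_comp, scaledCoord_intertwine he hAB hε,
      ContinuousLinearMap.comp_smul]
  ext1 t
  change T (bridgeMap (ε • matCLM A) (√ε • matCLM B) w t +
    bridgeMean (ε • matCLM A) (√ε • matCLM B) x y t - phi A B x y ε t) = _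
  rw [phi_eq_bridgeMean hAB.isControllable x y hε, add_sub_cancel_right,
    comp_bridgeMap hTA hinj hc.isUnit_gramian (hc.map hTA hsurj).isUnit_gramian, hTB]

lemma continuous_fluctuation (x y : EuclideanSpace ℝ (Fin d)) (ε : ℝ) :
    Continuous (fluctuation A B e x y ε) := by
  let L : EuclideanSpace ℝ (Fin d) →L[ℝ] EuclideanSpace ℝ (Fin d) :=
    (√ε)⁻¹ • scaledCoord A B e ε
  let p : PathSpace d := ⟨fun t => phi A B x y ε t,
    (continuous_phi A B x y ε).comp continuous_subtype_val⟩
  have h : Continuous fun z : PathSpace d => L.compLeftContinuous ℝ unitInterval (z - p) := by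
    fun_prop
  exact h

variable {x y : EuclideanSpace ℝ (Fin d)}

/-- The law of the bridge from `x` to `y`. -/
def bridgeKernel (A : Matrix (Fin d) (Fin d) ℝ) (B : Matrix (Fin d) (Fin m) ℝ)
    (W : unitInterval → Ω → EuclideanSpace ℝ (Fin m)) (P : Measure Ω) (x : EuclideanSpace ℝ (Fin d))
    (ε : ℝ) : Kernel (EuclideanSpace ℝ (Fin d)) (PathSpace d) :=
  shiftKernel (P.map fun ω => bridgeMap (ε • matCLM A) (√ε • matCLM B) (continuousVersion W ω))
    (bridgeMean (ε • matCLM A) (√ε • matCLM B) x)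

lemma IsBrownianMotion.isMarkovKernel_bridgeKernel (hW : IsBrownianMotion W P) (ε : ℝ) :
    IsMarkovKernel (bridgeKernel A B W P x ε) := by
  have := Measure.isProbabilityMeasure_map
    (hW.aemeasurable_clm (bridgeMap (ε • matCLM A) (√ε • matCLM B)))
  unfold bridgeKernel
  infer_instance

lemma IsDiffusion.isBridge {ε : ℝ} (hε : 0 < ε) {X : Ω → PathSpace d}
    (hX : IsDiffusion A B W P ε x X) (hW : IsBrownianMotion W P) (hAB : KalmanCondition A B)
    [IsMarkovKernel (bridgeKernel A B W P x ε)] : IsBridge X P (bridgeKernel A B W P x ε) := by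
  have := Measure.isProbabilityMeasure_map
    (hW.aemeasurable_clm (bridgeMap (ε • matCLM A) (√ε • matCLM B)))
  exact (hX.isLinearDiffusion hW).isBridge hW
    (hAB.isControllable.smul hε.ne' (Real.sqrt_pos.2 hε).ne').isUnit_gramian _ rfl

lemma IsDiffusion.eq_bridgeKernel {ε : ℝ} (hε : 0 < ε) {X : Ω → PathSpace d}
    (hX : IsDiffusion A B W P ε x X) (hW : IsBrownianMotion W P) (hAB : KalmanCondition A B)
    {κ : Kernel (EuclideanSpace ℝ (Fin d)) (PathSpace d)} [IsMarkovKernel κ]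
    (hκ : IsBridge X P κ) : κ = bridgeKernel A B W P x ε := by
  have := hW.isMarkovKernel_bridgeKernel (A := A) (B := B) (x := x) ε
  have := (hX.isLinearDiffusion hW).isOpenPosMeasure hW
    (hAB.isControllable.smul hε.ne' (Real.sqrt_pos.2 hε).ne').isUnit_gramian
  exact hκ.unique (hX.isBridge hε hW hAB)

/-- Realises the fluctuation laws for all `ε` as images of one Brownian path, with `x` and `y` gone.
-/
lemma map_fluctuation_bridgeKernel (hW : IsBrownianMotion W P) (he : IsAdapted A B e)
    (hAB : KalmanCondition A B) {ε : ℝ} (hε : 0 < ε) :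
    (bridgeKernel A B W P x ε y).map (fluctuation A B e x y ε) =
      P.map fun ω => bridgeMap (scaledGenerator A B e ε) (noiseCoord B e)
        (continuousVersion W ω) := by
  have hm := hW.aemeasurable_clm (bridgeMap (ε • matCLM A) (√ε • matCLM B))
  have := Measure.isProbabilityMeasure_map hm
  have hf := (continuous_fluctuation (A := A) (B := B) (e := e) x y ε).measurable
  have hadd : Measurable fun z : PathSpace d =>
      z + bridgeMean (ε • matCLM A) (√ε • matCLM B) x y := by fun_prop
  rw [bridgeKernel, shiftKernel_apply, Measure.map_map hf hadd,
    AEMeasurable.map_map_of_aemeasurable (hf.comp hadd).aemeasurable hm]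
  congr 1
  ext1 ω
  exact fluctuation_add_bridgeMean he hAB hε x y _

lemma tendstoInDistribution_fluctuation (hW : IsBrownianMotion W P) (he : IsAdapted A B e)
    (hAB : KalmanCondition A B) {κ : Set.Ioi (0 : ℝ) → Measure (PathSpace d)}
    [∀ ε, IsProbabilityMeasure (κ ε)] (hκ : ∀ ε, κ ε = bridgeKernel A B W P x ε y) :
    TendstoInDistribution (fun (ε : Set.Ioi (0 : ℝ)) (z : PathSpace d) => fluctuation A B e x y ε z)
      (comap Subtype.val (𝓝 0)) (fun ω => bridgeMap (scaledGenerator A B e 0) (noiseCoord B e)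
        (continuousVersion W ω)) κ P where
  forall_aemeasurable ε := (continuous_fluctuation x y ε).measurable.aemeasurable
  aemeasurable_limit := hW.aemeasurable_clm _
  tendsto := by
    refine ProbabilityMeasure.tendsto_iff_forall_integral_tendsto.2 fun f => ?_
    have hint (ε : ℝ) : ∫ z, f z ∂(P.map fun ω =>
        bridgeMap (scaledGenerator A B e ε) (noiseCoord B e) (continuousVersion W ω)) =
        ∫ ω, f (bridgeMap (scaledGenerator A B e ε) (noiseCoord B e)
          (continuousVersion W ω)) ∂P :=
      integral_map (hW.aemeasurable_clm _) f.continuous.measurable.aestronglyMeasurable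
    have h1 (ε : Set.Ioi (0 : ℝ)) : (κ ε).map (fun z => fluctuation A B e x y ε z) =
        P.map fun ω => bridgeMap (scaledGenerator A B e ε) (noiseCoord B e)
          (continuousVersion W ω) := by
      rw [hκ]
      exact map_fluctuation_bridgeKernel hW he hAB ε.2
    simp only [ProbabilityMeasure.coe_mk, h1, hint]
    refine tendsto_integral_filter_of_dominated_convergence (fun _ => ‖f‖)
      (.of_forall fun ε => ?_) (.of_forall fun ε => .of_forall fun ω => f.norm_coe_le_norm _)
      (integrable_const _) (.of_forall fun ω => ?_)
    · exact (f.continuous.measurable.comp_aemeasurable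
        (hW.aemeasurable_clm _)).aestronglyMeasurable
    -- Uniform convergence of the paths for each fixed `ω`: `ε = 0` is a continuity point of the
    -- bridge because the limiting Gramian is invertible.
    · have h2 : Tendsto (fun ε => bridgeMap (scaledGenerator A B e ε) (noiseCoord B e)
          (continuousVersion W ω)) (𝓝 0) (𝓝 (bridgeMap (scaledGenerator A B e 0) (noiseCoord B e)
            (continuousVersion W ω))) :=
        (continuousAt_bridgeMap (isControllable_scaledGenerator_zero he hAB).isUnit_gramian
          (continuousVersion W ω)).tendsto.comp (continuous_scaledGenerator.tendsto 0)
      exact (f.continuous.tendsto _).comp (h2.comp tendsto_comap)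

end Fluctuation

end KalmanBridge

end

/-! ### Assembly of the theorem. -/

open KalmanBridge in
theorem theorem1p2 {d m : ℕ}
    (A : Matrix (Fin d) (Fin d) ℝ) (B : Matrix (Fin d) (Fin m) ℝ) (hAB : KalmanCondition A B)
    (e : OrthonormalBasis (Fin d) ℝ (EuclideanSpace ℝ (Fin d))) (he : IsAdapted A B e)
    {Ω : Type*} [MeasurableSpace Ω] (P : Measure Ω) [IsProbabilityMeasure P]
    (W : unitInterval → Ω → EuclideanSpace ℝ (Fin m)) (hW : IsBrownianMotion W P) :
    -- the blocks `u_k` are the leading coefficients of `U^ε(r)`, uniformly on compact intervals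
    (∀ R : ℝ, ∃ C : ℝ, ∃ δ > 0, ∀ ε ∈ Set.Ioo 0 δ, ∀ r ∈ Set.Icc (-R) R, ∀ j c,
      |matU A B e ε r j c - ε ^ (level A B j - 1) * matUhat A B e r j c| ≤ C * ε ^ level A B j) ∧
    IsUnit (matV A B e) ∧
    -- `F` is a continuous version of the limit process, `S t` is the integral of `Û(t - s) dW_s`
    ∃ (S : unitInterval → Ω → EuclideanSpace ℝ (Fin d)) (F : Ω → PathSpace d),
      (∀ t, IsWienerIntegral W P t (fun s => matCLM (matUhat A B e (t - s))) (S t)) ∧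
      (∀ t, ∀ᵐ ω ∂P, F ω t =
        S t ω - matCLM (matJ A B t * matV A B e * matJ A B t * (matV A B e)⁻¹) (S 1 ω)) ∧
      IsGaussianProcess (fun t ω => F ω t) P ∧
      ∀ (x : EuclideanSpace ℝ (Fin d)) (X : Set.Ioi (0 : ℝ) → Ω → PathSpace d),
        (∀ ε : Set.Ioi (0 : ℝ), IsDiffusion A B W P ε x (X ε)) →
        -- the bridges exist and are unique
        (∀ ε : Set.Ioi (0 : ℝ), ∃! κ : Kernel (EuclideanSpace ℝ (Fin d)) (PathSpace d),
          ∃ _ : IsMarkovKernel κ, IsBridge (X ε) P κ) ∧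
        -- the rescaled fluctuations of the bridges from `x` to `y` converge weakly to `F`
        ∀ (κ : Set.Ioi (0 : ℝ) → Kernel (EuclideanSpace ℝ (Fin d)) (PathSpace d))
          [∀ ε, IsMarkovKernel (κ ε)], (∀ ε, IsBridge (X ε) P (κ ε)) →
          ∀ y : EuclideanSpace ℝ (Fin d),
            TendstoInDistribution
              (fun (ε : Set.Ioi (0 : ℝ)) (z : PathSpace d) => fluctuation A B e x y ε z)
              (comap Subtype.val (𝓝 0)) F (fun ε => κ ε y) P := by
  -- `S` and `F` are the solution and the bridge of the limiting system, as functionals of the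
  -- continuous version of `W`; neither depends on `x`, `y` or `ε`.
  refine ⟨fun R => ?_, isUnit_matV he hAB,
    fun t ω => linearResponse (scaledGenerator A B e 0) (noiseCoord B e) (continuousVersion W ω) t,
    fun ω => bridgeMap (scaledGenerator A B e 0) (noiseCoord B e) (continuousVersion W ω),
    fun t => ?_, fun t => .of_forall fun ω => ?_, hW.isGaussianProcess_clm _,
    fun x X hX => ⟨fun ε => ?_, fun κ _ hκ y => ?_⟩⟩
  · obtain ⟨C, hC⟩ := exists_abs_matU_sub_le he hAB R
    exact ⟨C, 1, one_pos, hC⟩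
  · simp_rw [← flow_scaledGenerator_zero he hAB]
    exact hW.isWienerIntegral_linearResponse _ _ t
  · rw [bridgeMap_apply, matCLM_regression he hAB t.2.1]
  · have := hW.isMarkovKernel_bridgeKernel (A := A) (B := B) (x := x) ε
    exact ⟨bridgeKernel A B W P x ε, ⟨this, (hX ε).isBridge ε.2 hW hAB⟩,
      fun κ ⟨_, hκ⟩ => (hX ε).eq_bridgeKernel ε.2 hW hAB hκ⟩
  · exact tendstoInDistribution_fluctuation hW he hAB fun ε => by
      rw [(hX ε).eq_bridgeKernel ε.2 hW hAB (hκ ε)]
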